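/- **Setting.** Let $\mathcal X,\mathcal Y_1,\mathcal Z_2,\mathcal Z_3$ be finite alphabets and let $p(y_1,z_2,z_3|x)$ be a 3-receiver discrete memoryless broadcast channel that is multilevel, i.e. $p(y_1,z_2,z_3|x)=p(y_1,z_3|x)\,p(z_2|y_1)$. A $(2^{nR_0},2^{nR_1},n)$ code consists of messages $(M_0,M_1)$ uniformly distributed on $[1:2^{nR_0}]\times[1:2^{nR_1}]$, a stochastic encoder $p(x^n|m_0,m_1)$, and three decoders, which map $y_1^n$ to an estimate $(\hat M_{01},\hat M_1)$ of $(M_0,M_1)$, $z_2^n$ to an estimate $\hat M_{02}$ of $M_0$, and $z_3^n$ to an estimate $\hat M_{03}$ of $M_0$, or to an error message. Its error probability is $P_e^{(n)}=\mathrm P\{\hat M_{0j}\ne M_0\text{ for some }j\in\{1,2,3\}\text{ or }\hat M_1\neq M_1\}$. A tuple $(R_0,R_1,R_{e2},R_{e3})$ with $R_0,R_1\ge 0$ is achievable if there is a sequence of $(2^{nR_0},2^{nR_1},n)$ codes with $\lim_{n\to\infty}P_e^{(n)}=0$ and $\liminf_{n\to\infty}\frac1n H(M_1|Z_j^n)\ge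 R_{ej}$ for $j=2,3$. The secrecy capacity region is the closure of the set of achievable tuples. Entropies are in bits, and $[a]^+=\max\{a,0\}$. **Proposition 3.** Every tuple $(R_0,R_1,R_{e2},R_{e3})$ in the secrecy capacity region of a multilevel broadcast channel satisfies \begin{align*} R_0 &\le \min\{I(U;Z_2),\, I(U_3;Z_3)\},\\ R_1 &\le I(V;Y_1|U),\\ R_0+R_1 &\le I(U_3;Z_3)+I(V;Y_1|U_3),\\ R_{e2} &\le I(X;Y_1|U)-I(X;Z_2|U),\\ R_{e2} &\le [I(U_3;Z_3)-R_0-I(U_3;Z_2|U)]^+ + I(X;Y_1|U_3)-I(X;Z_2|U_3),\\ R_{e3} &\le [I(V;Y_1|U_3)-I(V;Z_3|U_3)]^+ \end{align*} for some $p(u,u_3,v,x)=p(u)\,p(u_3|u)\,p(v|u_3)\,p(x|v)$ with auxiliary random variables $U,U_3,V$ taking values in finite sets, where $(U,U_3,V,X,Y_1,Z_2,Z_3)$ has the joint pmf $p(u)\,p(u_3|u)\,p(v|u_3)\,p(x|v)\,p(y_1,z_2,z_3|x)$. -/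

import Mathlib

open Filter Topology

noncomputable section

/-! ### Finite probability and Shannon information (in bits) -/

/-- `q` is a conditional pmf `q(b|a)` between finite alphabets: every `q a` is a pmf. -/
def IsCondPMF {α β : Type*} [Fintype β] (q : α → β → ℝ) : Prop :=
  ∀ a, q a ∈ stdSimplex ℝ β

open Classical in
/-- The pmf of the random variable `X` on the finite sample space `Ω` with pmf `p`. -/
def law {Ω α : Type*} [Fintype Ω] (p : Ω → ℝ) (X : Ω → α) (a : α) : ℝ :=
  ∑ ω, if X ω = a then p ω else 0

open Classical in
/-- The probability of the event `E`. -/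
def prob {Ω : Type*} [Fintype Ω] (p : Ω → ℝ) (E : Set Ω) : ℝ :=
  ∑ ω, if ω ∈ E then p ω else 0

/-- `H(X) = -∑ p(a) log₂ p(a)`. -/
def entropy {Ω α : Type*} [Fintype Ω] [Fintype α] (p : Ω → ℝ) (X : Ω → α) : ℝ :=
  -∑ a, law p X a * Real.logb 2 (law p X a)

/-- `H(X|Y) = -∑ p(a,b) log₂ p(a|b)`, where `p(a|b) = p(a,b)/p(b)`; terms with `p(a,b) = 0`
vanish. -/
def condEntropy {Ω α β : Type*} [Fintype Ω] [Fintype α] [Fintype β] (p : Ω → ℝ)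
    (X : Ω → α) (Y : Ω → β) : ℝ :=
  -∑ a, ∑ b, law p (fun ω => (X ω, Y ω)) (a, b) *
      Real.logb 2 (law p (fun ω => (X ω, Y ω)) (a, b) / law p Y b)

/-- `I(X;Y) = H(X) - H(X|Y)`. -/
def mutualInfo {Ω α β : Type*} [Fintype Ω] [Fintype α] [Fintype β] (p : Ω → ℝ)
    (X : Ω → α) (Y : Ω → β) : ℝ :=
  entropy p X - condEntropy p X Y

/-- `I(X;Y|Z) = H(X|Z) - H(X|Y,Z)`. -/
def condMutualInfo {Ω α β γ : Type*} [Fintype Ω] [Fintype α] [Fintype β] [Fintype γ]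
    (p : Ω → ℝ) (X : Ω → α) (Y : Ω → β) (Z : Ω → γ) : ℝ :=
  condEntropy p X Z - condEntropy p X (fun ω => (Y ω, Z ω))

/-! ### The channel -/

/-- A 3-receiver discrete memoryless broadcast channel, given by its conditional pmf
`p(y₁,z₂,z₃|x)`. -/
structure BroadcastChannel (𝒳 𝒴₁ 𝒵₂ 𝒵₃ : Type*) [Fintype 𝒴₁] [Fintype 𝒵₂] [Fintype 𝒵₃] where
  /-- the conditional pmf `p(y₁,z₂,z₃|x)` -/
  W : 𝒳 → 𝒴₁ × 𝒵₂ × 𝒵₃ → ℝ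
  isCondPMF : IsCondPMF W

/-- The channel is multilevel: `p(y₁,z₂,z₃|x) = p(y₁,z₃|x) p(z₂|y₁)`. -/
def BroadcastChannel.IsMultilevel {𝒳 𝒴₁ 𝒵₂ 𝒵₃ : Type*} [Fintype 𝒴₁] [Fintype 𝒵₂] [Fintype 𝒵₃]
    (ch : BroadcastChannel 𝒳 𝒴₁ 𝒵₂ 𝒵₃) : Prop :=
  ∃ (q : 𝒳 → 𝒴₁ × 𝒵₃ → ℝ) (r : 𝒴₁ → 𝒵₂ → ℝ), IsCondPMF q ∧ IsCondPMF r ∧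
    ∀ x y₁ z₂ z₃, ch.W x (y₁, z₂, z₃) = q x (y₁, z₃) * r y₁ z₂

/-! ### Codes -/

/-- A code of block length `n` with `k₀` common and `k₁` confidential messages: a stochastic
encoder `p(xⁿ|m₀,m₁)` and three decoders; the estimate `none` is the error message. -/
structure SecrecyCode (𝒳 𝒴₁ 𝒵₂ 𝒵₃ : Type*) [Fintype 𝒳] (n k₀ k₁ : ℕ) where
  enc : Fin k₀ × Fin k₁ → (Fin n → 𝒳) → ℝ
  enc_isCondPMF : IsCondPMF enc
  dec₁ : (Fin n → 𝒴₁) → Option (Fin k₀ × Fin k₁)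
  dec₂ : (Fin n → 𝒵₂) → Option (Fin k₀)
  dec₃ : (Fin n → 𝒵₃) → Option (Fin k₀)

namespace SecrecyCode

variable {𝒳 𝒴₁ 𝒵₂ 𝒵₃ : Type*} [Fintype 𝒳] [Fintype 𝒴₁] [Fintype 𝒵₂] [Fintype 𝒵₃]
  {n k₀ k₁ : ℕ}

/-- The joint pmf of `((M₀, M₁), Xⁿ, Y₁ⁿ, Z₂ⁿ, Z₃ⁿ)`: the messages are uniform on all pairs, the
codeword is drawn by the encoder, and the channel is used `n` times without memory. -/
def jointPMF (c : SecrecyCode 𝒳 𝒴₁ 𝒵₂ 𝒵₃ n k₀ k₁) (ch : BroadcastChannel 𝒳 𝒴₁ 𝒵₂ 𝒵₃) :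
    (Fin k₀ × Fin k₁) × (Fin n → 𝒳) × (Fin n → 𝒴₁) × (Fin n → 𝒵₂) × (Fin n → 𝒵₃) → ℝ :=
  fun (m, x, y₁, z₂, z₃) =>
    1 / ((k₀ : ℝ) * (k₁ : ℝ)) * c.enc m x * ∏ i, ch.W (x i) (y₁ i, z₂ i, z₃ i)

/-- The probability that some receiver misses `M₀` or the first receiver misses `M₁`. -/
def errorProb (c : SecrecyCode 𝒳 𝒴₁ 𝒵₂ 𝒵₃ n k₀ k₁) (ch : BroadcastChannel 𝒳 𝒴₁ 𝒵₂ 𝒵₃) : ℝ :=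
  prob (c.jointPMF ch) {ω | match ω with
    | (m, _, y₁, z₂, z₃) =>
      c.dec₁ y₁ ≠ some m ∨ c.dec₂ z₂ ≠ some m.1 ∨ c.dec₃ z₃ ≠ some m.1}

/-- `H(M₁|Z₂ⁿ)`. -/
def equivocation₂ (c : SecrecyCode 𝒳 𝒴₁ 𝒵₂ 𝒵₃ n k₀ k₁)
    (ch : BroadcastChannel 𝒳 𝒴₁ 𝒵₂ 𝒵₃) : ℝ :=
  condEntropy (c.jointPMF ch) (fun (m, _, _, _, _) => m.2) (fun (_, _, _, z₂, _) => z₂)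

/-- `H(M₁|Z₃ⁿ)`. -/
def equivocation₃ (c : SecrecyCode 𝒳 𝒴₁ 𝒵₂ 𝒵₃ n k₀ k₁)
    (ch : BroadcastChannel 𝒳 𝒴₁ 𝒵₂ 𝒵₃) : ℝ :=
  condEntropy (c.jointPMF ch) (fun (m, _, _, _, _) => m.2) (fun (_, _, _, _, z₃) => z₃)

end SecrecyCode

/-! ### The secrecy capacity region and the outer bound -/

section Region

variable {𝒳 𝒴₁ 𝒵₂ 𝒵₃ : Type*} [Fintype 𝒳] [Fintype 𝒴₁] [Fintype 𝒵₂] [Fintype 𝒵₃]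

/-- `(R₀, R₁, Rₑ₂, Rₑ₃)` is achievable: there are `(2^{nR₀}, 2^{nR₁}, n)` codes with vanishing
error probability and with asymptotic equivocation rates at least `Rₑ₂` and `Rₑ₃`. The message sets
`[1 : 2^{nR}]` consist of the `⌊2^{nR}⌋` positive integers up to `2^{nR}`. -/
def IsAchievable (ch : BroadcastChannel 𝒳 𝒴₁ 𝒵₂ 𝒵₃) (R₀ R₁ Re₂ Re₃ : ℝ) : Prop :=
  0 ≤ R₀ ∧ 0 ≤ R₁ ∧
  ∃ c : ∀ n : ℕ, SecrecyCode 𝒳 𝒴₁ 𝒵₂ 𝒵₃ n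
      ⌊(2 : ℝ) ^ ((n : ℝ) * R₀)⌋₊ ⌊(2 : ℝ) ^ ((n : ℝ) * R₁)⌋₊,
    Tendsto (fun n => (c n).errorProb ch) atTop (𝓝 0) ∧
    Re₂ ≤ liminf (fun n : ℕ => (c n).equivocation₂ ch / (n : ℝ)) atTop ∧
    Re₃ ≤ liminf (fun n : ℕ => (c n).equivocation₃ ch / (n : ℝ)) atTop

/-- The secrecy capacity region: the closure of the set of achievable rate tuples
`(R₀, R₁, Rₑ₂, Rₑ₃)`. -/
def secrecyCapacityRegion (ch : BroadcastChannel 𝒳 𝒴₁ 𝒵₂ 𝒵₃) : Set (ℝ × ℝ × ℝ × ℝ) :=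
  closure {R | IsAchievable ch R.1 R.2.1 R.2.2.1 R.2.2.2}

/-- The joint pmf `p(u) p(u₃|u) p(v|u₃) p(x|v) p(y₁,z₂,z₃|x)` of `(U, U₃, V, X, Y₁, Z₂, Z₃)`. -/
def auxPMF (ch : BroadcastChannel 𝒳 𝒴₁ 𝒵₂ 𝒵₃) {𝒰 𝒰₃ 𝒱 : Type*} (pU : 𝒰 → ℝ)
    (pU₃ : 𝒰 → 𝒰₃ → ℝ) (pV : 𝒰₃ → 𝒱 → ℝ) (pX : 𝒱 → 𝒳 → ℝ) :
    𝒰 × 𝒰₃ × 𝒱 × 𝒳 × 𝒴₁ × 𝒵₂ × 𝒵₃ → ℝ :=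
  fun (u, u₃, v, x, y) => pU u * pU₃ u u₃ * pV u₃ v * pX v x * ch.W x y

/-- The inequalities of the outer bound for the joint pmf `p` of `(U, U₃, V, X, Y₁, Z₂, Z₃)`. -/
def OuterInequalities {𝒰 𝒰₃ 𝒱 : Type*} [Fintype 𝒰] [Fintype 𝒰₃] [Fintype 𝒱]
    (p : 𝒰 × 𝒰₃ × 𝒱 × 𝒳 × 𝒴₁ × 𝒵₂ × 𝒵₃ → ℝ) (R₀ R₁ Re₂ Re₃ : ℝ) : Prop :=
  let U : 𝒰 × 𝒰₃ × 𝒱 × 𝒳 × 𝒴₁ × 𝒵₂ × 𝒵₃ → 𝒰 := fun (u, _, _, _, _, _, _) => u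
  let U₃ : 𝒰 × 𝒰₃ × 𝒱 × 𝒳 × 𝒴₁ × 𝒵₂ × 𝒵₃ → 𝒰₃ := fun (_, u₃, _, _, _, _, _) => u₃
  let V : 𝒰 × 𝒰₃ × 𝒱 × 𝒳 × 𝒴₁ × 𝒵₂ × 𝒵₃ → 𝒱 := fun (_, _, v, _, _, _, _) => v
  let X : 𝒰 × 𝒰₃ × 𝒱 × 𝒳 × 𝒴₁ × 𝒵₂ × 𝒵₃ → 𝒳 := fun (_, _, _, x, _, _, _) => x
  let Y₁ : 𝒰 × 𝒰₃ × 𝒱 × 𝒳 × 𝒴₁ × 𝒵₂ × 𝒵₃ → 𝒴₁ := fun (_, _, _, _, y₁, _, _) => y₁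
  let Z₂ : 𝒰 × 𝒰₃ × 𝒱 × 𝒳 × 𝒴₁ × 𝒵₂ × 𝒵₃ → 𝒵₂ := fun (_, _, _, _, _, z₂, _) => z₂
  let Z₃ : 𝒰 × 𝒰₃ × 𝒱 × 𝒳 × 𝒴₁ × 𝒵₂ × 𝒵₃ → 𝒵₃ := fun (_, _, _, _, _, _, z₃) => z₃
  R₀ ≤ min (mutualInfo p U Z₂) (mutualInfo p U₃ Z₃) ∧
  R₁ ≤ condMutualInfo p V Y₁ U ∧
  R₀ + R₁ ≤ mutualInfo p U₃ Z₃ + condMutualInfo p V Y₁ U₃ ∧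
  Re₂ ≤ condMutualInfo p X Y₁ U - condMutualInfo p X Z₂ U ∧
  Re₂ ≤ max (mutualInfo p U₃ Z₃ - R₀ - condMutualInfo p U₃ Z₂ U) 0 +
      condMutualInfo p X Y₁ U₃ - condMutualInfo p X Z₂ U₃ ∧
  Re₃ ≤ max (condMutualInfo p V Y₁ U₃ - condMutualInfo p V Z₃ U₃) 0

/-- The outer bound: all tuples `(R₀, R₁, Rₑ₂, Rₑ₃)` that satisfy the inequalities for some
`p(u) p(u₃|u) p(v|u₃) p(x|v)`, with auxiliary random variables in finite alphabets. -/
def outerBound (ch : BroadcastChannel 𝒳 𝒴₁ 𝒵₂ 𝒵₃) : Set (ℝ × ℝ × ℝ × ℝ) :=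
  {R | ∃ (a b d : ℕ) (pU : Fin a → ℝ) (pU₃ : Fin a → Fin b → ℝ) (pV : Fin b → Fin d → ℝ)
      (pX : Fin d → 𝒳 → ℝ),
    pU ∈ stdSimplex ℝ (Fin a) ∧ IsCondPMF pU₃ ∧ IsCondPMF pV ∧ IsCondPMF pX ∧
    OuterInequalities (auxPMF ch pU pU₃ pV pX) R.1 R.2.1 R.2.2.1 R.2.2.2}

end Region

end

open Filter Topology

noncomputable section

/-! ### Entropy as an expectation over the sample space -/

section Entropy

variable {Ω α β γ δ : Type*} [Fintype Ω] [Fintype α] [Fintype β] [Fintype γ] [Fintype δ]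
  {p : Ω → ℝ}

/-! The converse single-letterizes with U_i = (M₀, Y₁^{<i}), U₃_i = (U_i, Z₃^{>i}) and V_i = (U₃_i,
M₁). Fano's inequality makes H(M₀|Z₂ⁿ), H(M₀|Z₃ⁿ) and H(M₀,M₁|Y₁ⁿ) negligible against n, so rates
and equivocations are bounded by differences of n-letter output entropies, unconditional or given M₀
or (M₀,M₁). Three tools turn these into sums over letters: the chain rule; Csiszár's sum identity
`sum_condEntropy_sub`, which exchanges Y₁ⁿ for Z₃ⁿ; and degradedness of Z₂. Degradedness enters
twice: the past of Y₁ is at least as informative about the next Z₂ as the past of Z₂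
(`condEntropy_degraded_le`), and Y₁ⁿ is less noisy than Z₂ⁿ (`condEntropy_sub_le`). The third
receiver's bound on R₀ has a slack term I(U₃;Y₁|U); keeping it is what yields the bounds on R₀ + R₁
and on R₀ + Rₑ₂.

The auxiliary alphabets grow with n, so passing to the limit and to the closure needs compactness.
Of a chain (U, U₃, V, X) only a profile is kept: the law of X and the three output entropies given
V, given U₃ and given U. An output entropy H(Y|S) is an average of a function of the conditional
input law, so these data lie in an iterated convex hull of graphs, `profiles₃`. Its convexity
replaces the time-sharing variable. Its compactness, from Carathéodory's theorem, makes the region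
cut out by the single-letter inequalities closed (`isClosed_profileRegion`). Finally each point of
the iterated hull unfolds into finite kernels p(u), p(u₃|u), p(v|u₃), p(x|v)
(`mem_outerBound_of_profile`). On profiles the inequalities hold even without the positive parts. -/

lemma law_nonneg (hp : ∀ ω, 0 ≤ p ω) {α : Type*} (X : Ω → α) (a : α) : 0 ≤ law p X a := by
  classical
  unfold law
  exact Finset.sum_nonneg fun ω _ => by split_ifs <;> simp [hp]

lemma le_law (hp : ∀ ω, 0 ≤ p ω) {α : Type*} (X : Ω → α) (ω : Ω) : p ω ≤ law p X (X ω) := by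
  classical
  unfold law
  have := Finset.single_le_sum (f := fun ω' => if X ω' = X ω then p ω' else 0)
    (fun i _ => by split_ifs <;> simp [hp]) (Finset.mem_univ ω)
  simpa using this

lemma law_pos (hp : ∀ ω, 0 ≤ p ω) {α : Type*} (X : Ω → α) {ω : Ω} (h : 0 < p ω) :
    0 < law p X (X ω) := h.trans_le (le_law hp X ω)

lemma sum_law_mul (p : Ω → ℝ) (X : Ω → α) (g : α → ℝ) :
    ∑ a, law p X a * g a = ∑ ω, p ω * g (X ω) := by
  classical
  unfold law
  simp_rw [Finset.sum_mul]
  rw [Finset.sum_comm]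
  refine Finset.sum_congr rfl fun ω _ => ?_
  rw [Finset.sum_eq_single (X ω)] <;> simp +contextual [eq_comm]

lemma sum_law (p : Ω → ℝ) (X : Ω → α) : ∑ a, law p X a = ∑ ω, p ω := by
  simpa using sum_law_mul p X fun _ => 1

lemma law_congr {α β : Type*} (p : Ω → ℝ) {X : Ω → α} {Y : Ω → β} {a : α} {b : β}
    (h : ∀ ω, X ω = a ↔ Y ω = b) : law p X a = law p Y b := by
  classical
  unfold law
  exact Finset.sum_congr rfl fun ω _ => if_congr (h ω) rfl rfl

lemma sum_law_pair_left (p : Ω → ℝ) {β : Type*} (X : Ω → α) (Y : Ω → β) (b : β) :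
    ∑ a, law p (fun ω => (X ω, Y ω)) (a, b) = law p Y b := by
  classical
  unfold law
  rw [Finset.sum_comm]
  refine Finset.sum_congr rfl fun ω _ => ?_
  by_cases h : Y ω = b <;> simp [h]

lemma law_swap {α β : Type*} (p : Ω → ℝ) (X : Ω → α) (Y : Ω → β) (a : α) (b : β) :
    law p (fun ω => (X ω, Y ω)) (a, b) = law p (fun ω => (Y ω, X ω)) (b, a) :=
  law_congr p fun ω => by simp [and_comm]

lemma entropy_eq (p : Ω → ℝ) (X : Ω → α) :
    entropy p X = -∑ ω, p ω * Real.logb 2 (law p X (X ω)) := by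
  unfold entropy
  rw [sum_law_mul p X fun a => Real.logb 2 (law p X a)]

lemma condEntropy_eq_sum (p : Ω → ℝ) (X : Ω → α) (Y : Ω → β) :
    condEntropy p X Y = -∑ ω, p ω * Real.logb 2
      (law p (fun ω => (X ω, Y ω)) (X ω, Y ω) / law p Y (Y ω)) := by
  unfold condEntropy
  rw [← sum_law_mul p (fun ω => (X ω, Y ω)) fun ab => Real.logb 2
    (law p (fun ω => (X ω, Y ω)) ab / law p Y ab.2), Fintype.sum_prod_type]

lemma condEntropy_eq (hp : ∀ ω, 0 ≤ p ω) (X : Ω → α) (Y : Ω → β) :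
    condEntropy p X Y = entropy p (fun ω => (X ω, Y ω)) - entropy p Y := by
  rw [condEntropy_eq_sum, entropy_eq, entropy_eq, neg_sub_neg, ← Finset.sum_sub_distrib,
    ← Finset.sum_neg_distrib]
  refine Finset.sum_congr rfl fun ω _ => ?_
  rcases (hp ω).eq_or_lt with h | h
  · simp [← h]
  · rw [Real.logb_div (law_pos hp _ h).ne' (law_pos hp _ h).ne']
    ring

/-- Entropy depends only on the partition of the sample space. -/
lemma entropy_congr (p : Ω → ℝ) {X : Ω → α} {Y : Ω → β}
    (h : ∀ ω ω', X ω = X ω' ↔ Y ω = Y ω') : entropy p X = entropy p Y := by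
  rw [entropy_eq, entropy_eq]
  refine congrArg _ (Finset.sum_congr rfl fun ω _ => ?_)
  rw [law_congr p fun ω' => h ω' ω]

lemma condEntropy_congr (hp : ∀ ω, 0 ≤ p ω) {X : Ω → α} {Y : Ω → β} {X' : Ω → γ} {Y' : Ω → δ}
    (h : ∀ ω ω', X ω = X ω' ∧ Y ω = Y ω' ↔ X' ω = X' ω' ∧ Y' ω = Y' ω')
    (h' : ∀ ω ω', Y ω = Y ω' ↔ Y' ω = Y' ω') : condEntropy p X Y = condEntropy p X' Y' := by
  rw [condEntropy_eq hp, condEntropy_eq hp, entropy_congr p h',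
    entropy_congr p (Y := fun ω => (X' ω, Y' ω)) (by simpa using h)]

/-- **Gibbs' inequality** for conditional entropy. -/
lemma condEntropy_le_of_subPMF (hp : ∀ ω, 0 ≤ p ω) (X : Ω → α) (Y : Ω → β) (q : α → β → ℝ)
    (hq : ∀ a b, 0 ≤ q a b) (hq1 : ∀ b, ∑ a, q a b ≤ 1)
    (hpos : ∀ ω, 0 < p ω → 0 < q (X ω) (Y ω)) :
    condEntropy p X Y ≤ -∑ ω, p ω * Real.logb 2 (q (X ω) (Y ω)) := by
  rw [condEntropy_eq_sum, neg_le_neg_iff, ← sub_nonpos, ← Finset.sum_sub_distrib]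
  have hl2 : 0 < Real.log 2 := Real.log_pos (by norm_num)
  have key : ∀ ω, p ω * Real.logb 2 (q (X ω) (Y ω)) - p ω * Real.logb 2
      (law p (fun ω => (X ω, Y ω)) (X ω, Y ω) / law p Y (Y ω)) ≤
      (p ω * (q (X ω) (Y ω) * law p Y (Y ω) / law p (fun ω => (X ω, Y ω)) (X ω, Y ω)) - p ω)
        / Real.log 2 := by
    intro ω
    rcases (hp ω).eq_or_lt with h | h
    · simp [← h]
    · have h1 := law_pos hp (fun ω => (X ω, Y ω)) h
      have h2 := law_pos hp Y h
      have h3 := hpos ω h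
      have := Real.log_le_sub_one_of_pos (div_pos (mul_pos h3 h2) h1)
      rw [Real.log_div (mul_pos h3 h2).ne' h1.ne', Real.log_mul h3.ne' h2.ne'] at this
      rw [Real.logb, Real.logb, Real.log_div h1.ne' h2.ne', ← mul_sub, ← sub_div, ← mul_div_assoc,
        ← mul_sub_one]
      exact div_le_div_of_nonneg_right (mul_le_mul_of_nonneg_left (by linarith) h.le) hl2.le
  refine (Finset.sum_le_sum fun ω _ => key ω).trans ?_
  rw [← Finset.sum_div, Finset.sum_sub_distrib]
  refine div_nonpos_of_nonpos_of_nonneg (sub_nonpos.2 ?_) hl2.le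
  rw [← sum_law_mul p (fun ω => (X ω, Y ω)) fun ab => q ab.1 ab.2 * law p Y ab.2 /
    law p (fun ω => (X ω, Y ω)) ab]
  calc ∑ ab, law p (fun ω => (X ω, Y ω)) ab * (q ab.1 ab.2 * law p Y ab.2 /
        law p (fun ω => (X ω, Y ω)) ab)
      ≤ ∑ ab : α × β, q ab.1 ab.2 * law p Y ab.2 := by
        refine Finset.sum_le_sum fun ab _ => ?_
        rcases (law_nonneg hp (fun ω => (X ω, Y ω)) ab).eq_or_lt with h | h
        · rw [← h, zero_mul]
          exact mul_nonneg (hq _ _) (law_nonneg hp _ _)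
        · rw [mul_div_cancel₀ _ h.ne']
    _ = ∑ b, (∑ a, q a b) * law p Y b := by
        rw [Fintype.sum_prod_type_right]
        simp [Finset.sum_mul]
    _ ≤ ∑ b, law p Y b := by
        refine Finset.sum_le_sum fun b _ => ?_
        exact mul_le_of_le_one_left (law_nonneg hp _ _) (hq1 b)
    _ = ∑ ω, p ω := sum_law p Y

/-- Conditioning reduces entropy. -/
lemma condEntropy_le_of_factorsThrough (hp : ∀ ω, 0 ≤ p ω) (X : Ω → α) {Y : Ω → β} {Z : Ω → γ}
    (h : Z.FactorsThrough Y) : condEntropy p X Y ≤ condEntropy p X Z := by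
  rw [condEntropy_congr (Y' := fun ω => (Y ω, Z ω)) (X' := X) hp
    (fun ω ω' => by simpa using fun _ hy => h hy) (fun ω ω' => by simpa using fun hy => h hy)]
  -- The comparison kernel is p(a|z), which ignores y. At null z the quotient is 0, which is why
  -- Gibbs' inequality is stated for total mass at most 1.
  refine (condEntropy_le_of_subPMF hp X (fun ω => (Y ω, Z ω))
    (fun a yz => law p (fun ω => (X ω, Z ω)) (a, yz.2) / law p Z yz.2)
    (fun a b => div_nonneg (law_nonneg hp _ _) (law_nonneg hp _ _)) (fun b => ?_)
    (fun ω hω => div_pos (law_pos hp (fun ω => (X ω, Z ω)) hω) (law_pos hp _ hω))).trans_eq ?_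
  · rw [← Finset.sum_div, sum_law_pair_left]
    exact div_self_le_one _
  · rw [condEntropy_eq_sum]

lemma condEntropy_nonneg (hp : ∀ ω, 0 ≤ p ω) (X : Ω → α) (Y : Ω → β) : 0 ≤ condEntropy p X Y := by
  rw [condEntropy_eq_sum, neg_nonneg]
  refine Finset.sum_nonpos fun ω _ => mul_nonpos_of_nonneg_of_nonpos (hp ω) ?_
  refine Real.logb_nonpos (by norm_num) (div_nonneg (law_nonneg hp _ _) (law_nonneg hp _ _))
    (div_le_one_of_le₀ ?_ (law_nonneg hp _ _))
  unfold law
  refine Finset.sum_le_sum fun ω' _ => ?_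
  split_ifs with h1 h2
  · rfl
  · exact absurd (congrArg Prod.snd h1) h2
  · exact hp _
  · rfl

/-- The entropy of a function of a random variable is at most its entropy. -/
lemma entropy_le_of_factorsThrough (hp : ∀ ω, 0 ≤ p ω) {X : Ω → α} {Y : Ω → β}
    (h : X.FactorsThrough Y) : entropy p X ≤ entropy p Y := by
  have h1 := condEntropy_nonneg hp Y X
  rw [condEntropy_eq hp, entropy_congr p (Y := Y) fun ω ω' => by simpa using fun hy => h hy] at h1
  linarith

lemma law_const_unit (p : Ω → ℝ) (u : Unit) : law p (fun _ => ()) u = ∑ ω, p ω := by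
  simp [law]

lemma entropy_unit (hp1 : ∑ ω, p ω = 1) : entropy p (fun _ : Ω => ()) = 0 := by
  simp [entropy, law_const_unit, hp1]

lemma condEntropy_le_entropy (hp : ∀ ω, 0 ≤ p ω) (hp1 : ∑ ω, p ω = 1) (X : Ω → α) (Y : Ω → β) :
    condEntropy p X Y ≤ entropy p X := by
  have := condEntropy_le_of_factorsThrough (Z := fun _ => ()) hp X (Y := Y) fun _ _ _ => rfl
  rwa [condEntropy_eq hp X fun _ => (), entropy_unit hp1, sub_zero,
    entropy_congr p (Y := X) fun ω ω' => by simp] at this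

/-- **Fano's inequality.** -/
lemma condEntropy_le_fano [Nonempty α] (hp : ∀ ω, 0 ≤ p ω) (hp1 : ∑ ω, p ω = 1) (X : Ω → α)
    (Y : Ω → β) (dec : β → Option α) (E : Set Ω) (hE : ∀ ω, ω ∉ E → dec (Y ω) = some (X ω)) :
    condEntropy p X Y ≤ 1 + prob p E * Real.logb 2 (Fintype.card α) := by
  classical
  have hk : (0 : ℝ) < Fintype.card α := by exact_mod_cast Fintype.card_pos
  -- Gibbs' inequality against the mixture of half a point mass at the decoded value and half the
  -- uniform law. A correct decision costs at most log₂ 2 = 1 bit, an error at most 1 + log₂ |α|;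
  -- averaging gives the bound without a binary entropy term.
  refine (condEntropy_le_of_subPMF hp X Y
    (fun a b => (if dec b = some a then 1 / 2 else 0) + 1 / 2 * (1 / (Fintype.card α : ℝ)))
    (fun a b => by positivity) (fun b => ?_) (fun ω _ => by positivity)).trans ?_
  · rw [Finset.sum_add_distrib, Finset.sum_const, Finset.card_univ, nsmul_eq_mul]
    have : ∑ a : α, (if dec b = some a then (1 / 2 : ℝ) else 0) ≤ 1 / 2 := by
      cases h : dec b with
      | none => simp
      | some a => simp
    have h2 : (Fintype.card α : ℝ) * (1 / 2 * (1 / Fintype.card α)) = 1 / 2 := by field_simp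
    linarith
  · rw [← Finset.sum_neg_distrib]
    have : (1 : ℝ) + prob p E * Real.logb 2 (Fintype.card α) =
        ∑ ω, (p ω + (if ω ∈ E then p ω else 0) * Real.logb 2 (Fintype.card α)) := by
      rw [Finset.sum_add_distrib, hp1, ← Finset.sum_mul]
      rfl
    rw [this]
    refine Finset.sum_le_sum fun ω _ => ?_
    have hhalf : Real.logb 2 (1 / 2) = -1 := by
      rw [one_div, Real.logb_inv, Real.logb_self_eq_one (by norm_num)]
    split_ifs with h1 h2 h2
    · have : (-1 : ℝ) ≤ Real.logb 2 (1 / 2 + 1 / 2 * (1 / (Fintype.card α : ℝ))) := by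
        rw [← hhalf]
        exact Real.logb_le_logb_of_le (by norm_num) (by norm_num)
          (le_add_of_nonneg_right (by positivity))
      have h3 : 0 ≤ Real.logb 2 (Fintype.card α) :=
        Real.logb_nonneg (by norm_num) (by exact_mod_cast Fintype.card_pos)
      nlinarith [hp ω, mul_nonneg (hp ω) h3, mul_nonneg (hp ω) (sub_nonneg.2 this)]
    · have : (-1 : ℝ) ≤ Real.logb 2 (1 / 2 + 1 / 2 * (1 / (Fintype.card α : ℝ))) := by
        rw [← hhalf]
        exact Real.logb_le_logb_of_le (by norm_num) (by norm_num)
          (le_add_of_nonneg_right (by positivity))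
      nlinarith [hp ω, mul_nonneg (hp ω) (sub_nonneg.2 this)]
    · rw [zero_add, Real.logb_mul (by norm_num) (by positivity), hhalf, one_div, Real.logb_inv]
      linarith
    · exact absurd (hE ω h2) h1

lemma entropy_eq_of_uniform [Nonempty α] (X : Ω → α)
    (h : ∀ a, law p X a = 1 / Fintype.card α) : entropy p X = Real.logb 2 (Fintype.card α) := by
  have hk : (0 : ℝ) < Fintype.card α := by exact_mod_cast Fintype.card_pos
  simp only [entropy, h, Finset.sum_const, Finset.card_univ, nsmul_eq_mul]
  rw [one_div, Real.logb_inv]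
  field_simp

end Entropy

/-! ### Chain rules for sequences -/

section Chain

variable {Ω α β σ : Type*} [Fintype Ω] [Fintype α] [Fintype β] [Fintype σ] {p : Ω → ℝ} {n : ℕ}

/-- The first `k` entries of a random sequence. -/
def prefixMask {Ω α : Type*} {n : ℕ} (k : ℕ) (Y : Ω → Fin n → α) (ω : Ω) : Fin n → Option α :=
  fun j => if (j : ℕ) < k then some (Y ω j) else none

/-- The entries of a random sequence from position `k` on. -/
def suffixMask {Ω α : Type*} {n : ℕ} (k : ℕ) (Y : Ω → Fin n → α) (ω : Ω) : Fin n → Option α :=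
  fun j => if k ≤ (j : ℕ) then some (Y ω j) else none

lemma prefixMask_eq_iff {Ω α : Type*} {k : ℕ} {Y : Ω → Fin n → α} {ω ω' : Ω} :
    prefixMask k Y ω = prefixMask k Y ω' ↔ ∀ j : Fin n, (j : ℕ) < k → Y ω j = Y ω' j := by
  simp only [prefixMask, funext_iff]
  refine forall_congr' fun j => ?_
  by_cases h : (j : ℕ) < k <;> simp [h]

lemma suffixMask_eq_iff {Ω α : Type*} {k : ℕ} {Y : Ω → Fin n → α} {ω ω' : Ω} :
    suffixMask k Y ω = suffixMask k Y ω' ↔ ∀ j : Fin n, k ≤ (j : ℕ) → Y ω j = Y ω' j := by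
  simp only [suffixMask, funext_iff]
  refine forall_congr' fun j => ?_
  by_cases h : k ≤ (j : ℕ) <;> simp [h]

lemma forall_fin_lt_succ_iff {P : Fin n → Prop} {k : Fin n} :
    (∀ j : Fin n, (j : ℕ) < k + 1 → P j) ↔ P k ∧ ∀ j : Fin n, (j : ℕ) < k → P j := by
  constructor
  · exact fun h => ⟨h k (by omega), fun j hj => h j (by omega)⟩
  · rintro ⟨h1, h2⟩ j hj
    rcases Nat.lt_succ_iff_lt_or_eq.1 hj with h | h
    · exact h2 j h
    · rwa [Fin.ext h]

lemma forall_fin_ge_iff {P : Fin n → Prop} {k : Fin n} :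
    (∀ j : Fin n, (k : ℕ) ≤ j → P j) ↔ P k ∧ ∀ j : Fin n, (k : ℕ) + 1 ≤ j → P j := by
  constructor
  · exact fun h => ⟨h k le_rfl, fun j hj => h j (by omega)⟩
  · rintro ⟨h1, h2⟩ j hj
    rcases hj.eq_or_lt with h | h
    · rwa [← Fin.ext h]
    · exact h2 j h

/-- Induction on the prefix length, splitting off the last entry. Proper prefixes are needed later,
for the past of the degraded output. -/
lemma sum_condEntropy_prefixMask (hp : ∀ ω, 0 ≤ p ω) (Y : Ω → Fin n → α) (S : Ω → σ) {k : ℕ}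
    (hk : k ≤ n) :
    ∑ j ∈ Finset.univ.filter (fun j : Fin n => (j : ℕ) < k),
      condEntropy p (fun ω => Y ω j) (fun ω => (prefixMask j Y ω, S ω)) =
      condEntropy p (prefixMask k Y) S := by
  induction k with
  | zero =>
    rw [condEntropy_eq hp, entropy_congr p (X := fun ω => (prefixMask 0 Y ω, S ω)) (Y := S)]
    · simp
    · intro ω ω'
      simp [prefixMask_eq_iff]
  | succ k ih =>
    have : Finset.univ.filter (fun j : Fin n => (j : ℕ) < k + 1) =
        insert ⟨k, hk⟩ (Finset.univ.filter (fun j : Fin n => (j : ℕ) < k)) := by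
      ext j
      simp [Fin.ext_iff]
      omega
    rw [this, Finset.sum_insert (by simp), ih (by omega), condEntropy_eq hp, condEntropy_eq hp,
      condEntropy_eq hp, sub_add_sub_cancel]
    congr 1
    refine entropy_congr p fun ω ω' => ?_
    have := forall_fin_lt_succ_iff (k := ⟨k, hk⟩) (P := fun j => Y ω j = Y ω' j)
    simp only [Prod.mk.injEq, prefixMask_eq_iff, this, and_assoc]

lemma sum_condEntropy_chain (hp : ∀ ω, 0 ≤ p ω) (Y : Ω → Fin n → α) (S : Ω → σ) :
    ∑ j : Fin n, condEntropy p (fun ω => Y ω j) (fun ω => (prefixMask j Y ω, S ω)) =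
      condEntropy p Y S := by
  have := sum_condEntropy_prefixMask hp Y S le_rfl
  rw [Finset.filter_true_of_mem fun j _ => j.is_lt] at this
  rw [this]
  refine condEntropy_congr hp (fun ω ω' => ?_) fun _ _ => Iff.rfl
  simp [prefixMask_eq_iff, funext_iff (f := Y ω)]

lemma entropy_le_sum (hp : ∀ ω, 0 ≤ p ω) (hp1 : ∑ ω, p ω = 1) (Y : Ω → Fin n → α) :
    entropy p Y ≤ ∑ j : Fin n, entropy p (fun ω => Y ω j) := by
  have h := sum_condEntropy_chain hp Y fun _ => ()
  rw [condEntropy_eq hp, entropy_unit hp1, sub_zero,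
    entropy_congr p (X := fun ω => (Y ω, ())) (Y := Y) fun ω ω' => by simp] at h
  rw [← h]
  exact Finset.sum_le_sum fun j _ => condEntropy_le_entropy hp hp1 _ _

/-- **Csiszár's sum identity**, in telescoping form. -/
lemma sum_condEntropy_sub (hp : ∀ ω, 0 ≤ p ω) (Y : Ω → Fin n → α) (Z : Ω → Fin n → β)
    (S : Ω → σ) :
    ∑ j : Fin n, (condEntropy p (fun ω => Y ω j)
        (fun ω => (prefixMask j Y ω, suffixMask (j + 1) Z ω, S ω)) -
      condEntropy p (fun ω => Z ω j)
        (fun ω => (prefixMask j Y ω, suffixMask (j + 1) Z ω, S ω))) =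
      condEntropy p Y S - condEntropy p Z S := by
  -- The entropies of the common condition cancel. Adjoining Y_j lengthens the prefix and adjoining
  -- Z_j lengthens the suffix, so the summand is an increment of j ↦ H(Y^{<j}, Z^{≥j}, S).
  have key : ∀ j : Fin n, condEntropy p (fun ω => Y ω j)
        (fun ω => (prefixMask j Y ω, suffixMask (j + 1) Z ω, S ω)) -
      condEntropy p (fun ω => Z ω j)
        (fun ω => (prefixMask j Y ω, suffixMask (j + 1) Z ω, S ω)) =
      entropy p (fun ω => (prefixMask ((j : ℕ) + 1) Y ω, suffixMask ((j : ℕ) + 1) Z ω, S ω)) -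
      entropy p (fun ω => (prefixMask (j : ℕ) Y ω, suffixMask (j : ℕ) Z ω, S ω)) := by
    intro j
    rw [condEntropy_eq hp, condEntropy_eq hp, sub_sub_sub_cancel_right]
    congr 1
    · refine entropy_congr p fun ω ω' => ?_
      simp only [Prod.mk.injEq, prefixMask_eq_iff, suffixMask_eq_iff,
        forall_fin_lt_succ_iff, and_assoc]
    · refine entropy_congr p fun ω ω' => ?_
      simp only [Prod.mk.injEq, prefixMask_eq_iff, suffixMask_eq_iff,
        forall_fin_ge_iff (k := j), and_assoc]
      tauto
  simp_rw [key]
  rw [Fin.sum_univ_eq_sum_range (fun j => entropy p (fun ω =>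
      (prefixMask (j + 1) Y ω, suffixMask (j + 1) Z ω, S ω)) -
      entropy p (fun ω => (prefixMask j Y ω, suffixMask j Z ω, S ω))),
    Finset.sum_range_sub (fun j => entropy p (fun ω =>
      (prefixMask j Y ω, suffixMask j Z ω, S ω))), condEntropy_eq hp, condEntropy_eq hp,
    sub_sub_sub_cancel_right]
  congr 1
  · refine entropy_congr p fun ω ω' => ?_
    simp only [Prod.mk.injEq, prefixMask_eq_iff, suffixMask_eq_iff, funext_iff (f := Y ω)]
    simp [Fin.is_lt, fun j : Fin n => j.is_lt.not_ge]
  · refine entropy_congr p fun ω ω' => ?_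
    simp [prefixMask_eq_iff, suffixMask_eq_iff, funext_iff (f := Z ω)]

end Chain

/-! ### Channels -/

section Channel

variable {Ω α β γ σ τ : Type*} [Fintype Ω] [Fintype α] [Fintype β] [Fintype γ] [Fintype σ]
  [Fintype τ] {p : Ω → ℝ}

/-- Given `(S, X)`, the random variable `Y` is the output of the channel `W` with input `X`. -/
def ChannelLaw {Ω σ α β : Type*} [Fintype Ω] (p : Ω → ℝ) (S : Ω → σ) (X : Ω → α) (Y : Ω → β)
    (W : α → β → ℝ) : Prop :=
  ∀ s x y, law p (fun ω => (S ω, X ω, Y ω)) (s, x, y) =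
    law p (fun ω => (S ω, X ω)) (s, x) * W x y

open Classical in
lemma law_comp_pair (p : Ω → ℝ) {γ τ : Type*} (S : Ω → σ) (f : σ → τ) (Z : Ω → γ) (t : τ) (z : γ) :
    law p (fun ω => (f (S ω), Z ω)) (t, z) =
      ∑ s, if f s = t then law p (fun ω => (S ω, Z ω)) (s, z) else 0 := by
  have : ∀ s, (if f s = t then law p (fun ω => (S ω, Z ω)) (s, z) else 0) =
      ∑ ω, if S ω = s then (if f (S ω) = t ∧ Z ω = z then p ω else 0) else 0 := by
    intro s
    by_cases hs : f s = t
    · rw [if_pos hs, law]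
      refine Finset.sum_congr rfl fun ω _ => ?_
      by_cases h1 : S ω = s
      · by_cases h2 : Z ω = z <;> simp [h1, h2, hs]
      · simp [h1]
    · rw [if_neg hs]
      refine (Finset.sum_eq_zero fun ω _ => ?_).symm
      by_cases h1 : S ω = s
      · simp [h1, hs]
      · simp [h1]
  simp_rw [this]
  rw [Finset.sum_comm, law]
  refine Finset.sum_congr rfl fun ω _ => ?_
  rw [Finset.sum_ite_eq, if_pos (Finset.mem_univ _)]
  by_cases h1 : f (S ω) = t <;> by_cases h2 : Z ω = z <;> simp [h1, h2]

lemma sum_law_pair_right (p : Ω → ℝ) {α : Type*} (X : Ω → α) (Y : Ω → β) (a : α) :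
    ∑ b, law p (fun ω => (X ω, Y ω)) (a, b) = law p X a := by
  simp_rw [law_swap p X Y]
  exact sum_law_pair_left p Y X a

namespace ChannelLaw

/-- Sum the factorization over all s with f(s) = t: the factor `W x y` does not involve s. One law
with a rich S thus yields the Markov relations for every coarser conditioning. -/
lemma of_factorsThrough {α β τ : Type*} {S : Ω → σ} {X : Ω → α} {Y : Ω → β} {W : α → β → ℝ}
    (h : ChannelLaw p S X Y W) {S' : Ω → τ} (hS : S'.FactorsThrough S) :
    ChannelLaw p S' X Y W := by
  intro t x y
  have : Nonempty τ := ⟨t⟩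
  obtain ⟨f, rfl⟩ := (Function.factorsThrough_iff _).1 hS
  simp only [Function.comp_apply]
  rw [law_comp_pair p S f (fun ω => (X ω, Y ω)), law_comp_pair p S f X, Finset.sum_mul]
  refine Finset.sum_congr rfl fun s _ => ?_
  rw [h, ite_mul, zero_mul]

lemma map_output {σ α γ : Type*} {S : Ω → σ} {X : Ω → α} {Y : Ω → β} {W : α → β → ℝ}
    (h : ChannelLaw p S X Y W) (g : β → γ) :
    ChannelLaw p S X (fun ω => g (Y ω)) fun x => law (W x) g := by
  classical
  intro s x c
  rw [law_congr p (Y := fun ω => (g (Y ω), (S ω, X ω))) (b := (c, (s, x)))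
    fun ω => by simp; tauto, law_comp_pair p Y g fun ω => (S ω, X ω)]
  simp only [law, Finset.mul_sum]
  refine Finset.sum_congr rfl fun b _ => ?_
  split_ifs
  · rw [← law.eq_def, ← law.eq_def, ← h]
    exact law_congr p fun ω => by simp; tauto
  · simp

lemma law_input_output {σ α β : Type*} {S : Ω → σ} {X : Ω → α} {Y : Ω → β}
    {W : α → β → ℝ} [Fintype σ]
    (h : ChannelLaw p S X Y W) (x : α) (y : β) :
    law p (fun ω => (X ω, Y ω)) (x, y) = law p X x * W x y := by
  have := h.of_factorsThrough (S' := fun _ => ()) (fun _ _ _ => rfl) () x y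
  rw [law_congr p (Y := fun ω => (X ω, Y ω)) (b := (x, y)) (by simp),
    law_congr p (X := fun ω => ((), X ω)) (Y := X) (b := x) (by simp)] at this
  exact this

end ChannelLaw

/-- The output entropy of the channel `W` for the unnormalized input distribution `π`; it is
positively homogeneous in `π`. -/
def outputEntropy (W : α → β → ℝ) (π : α → ℝ) : ℝ :=
  -∑ y, (∑ x, π x * W x y) * Real.logb 2 ((∑ x, π x * W x y) / ∑ x, π x)

/-- The entropy of the output of the channel `W` for the input letter `x`. -/
def rowEntropy {α : Type*} (W : α → β → ℝ) (x : α) : ℝ :=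
  -∑ y, W x y * Real.logb 2 (W x y)

lemma outputEntropy_smul (W : α → β → ℝ) (t : ℝ) (π : α → ℝ) :
    outputEntropy W (t • π) = t * outputEntropy W π := by
  -- At t = 0 the quotient has denominator 0, but every term also carries a vanishing factor.
  rcases eq_or_ne t 0 with rfl | ht
  · simp [outputEntropy]
  · simp only [outputEntropy, Pi.smul_apply, smul_eq_mul, mul_assoc, ← Finset.mul_sum,
      mul_div_mul_left _ _ ht]
    simp

lemma outputEntropy_eq_of_mem_stdSimplex (W : α → β → ℝ) {π : α → ℝ} (hπ : π ∈ stdSimplex ℝ α) :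
    outputEntropy W π = ∑ y, Real.negMulLog (∑ x, π x * W x y) / Real.log 2 := by
  simp only [outputEntropy, hπ.2, div_one, Real.logb, Real.negMulLog]
  rw [← Finset.sum_neg_distrib]
  exact Finset.sum_congr rfl fun y _ => by ring

/-- On the simplex the denominator is 1, leaving `negMulLog` of functions linear in the input law.
-/
lemma continuousOn_outputEntropy (W : α → β → ℝ) :
    ContinuousOn (outputEntropy W) (stdSimplex ℝ α) := by
  have : Continuous fun π : α → ℝ => ∑ y, Real.negMulLog (∑ x, π x * W x y) / Real.log 2 := by
    fun_prop
  exact this.continuousOn.congr fun π hπ => outputEntropy_eq_of_mem_stdSimplex W hπ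

namespace ChannelLaw

variable {S : Ω → σ} {X : Ω → α} {Y : Ω → β} {W : α → β → ℝ}

/-- The slices x ↦ p(s,x) are used unnormalized: the weight p(s) is absorbed by homogeneity, so null
values of s need no separate treatment. -/
lemma condEntropy_eq_sum_outputEntropy (h : ChannelLaw p S X Y W) :
    condEntropy p Y S =
      ∑ s, outputEntropy W fun x => law p (fun ω => (S ω, X ω)) (s, x) := by
  unfold condEntropy outputEntropy
  rw [Finset.sum_comm, ← Finset.sum_neg_distrib]
  refine Finset.sum_congr rfl fun s _ => congrArg _ (Finset.sum_congr rfl fun y _ => ?_)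
  have h1 : law p (fun ω => (Y ω, S ω)) (y, s) =
      ∑ x, law p (fun ω => (S ω, X ω)) (s, x) * W x y := by
    simp_rw [← h s _ y]
    rw [← sum_law_pair_left p X]
    refine Finset.sum_congr rfl fun x _ => law_congr p fun ω => ?_
    simp only [Prod.mk.injEq]
    tauto
  rw [h1, sum_law_pair_right]

lemma entropy_eq_outputEntropy (h : ChannelLaw p S X Y W) (hp : ∀ ω, 0 ≤ p ω)
    (hp1 : ∑ ω, p ω = 1) : entropy p Y = outputEntropy W (law p X) := by
  have h1 := (h.of_factorsThrough (S' := fun _ => ())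
    fun _ _ _ => rfl).condEntropy_eq_sum_outputEntropy
  rw [condEntropy_eq hp, entropy_unit hp1, sub_zero,
    entropy_congr p (Y := Y) fun ω ω' => by simp] at h1
  rw [h1]
  simp only [Finset.univ_unique, Finset.sum_singleton]
  exact congrArg _ (funext fun x => law_congr p fun ω => by simp)

/-- Once S determines the input, p(y|s) = W(y|x), and the rest of S is irrelevant. -/
lemma condEntropy_eq_sum_rowEntropy (h : ChannelLaw p S X Y W) (hp : ∀ ω, 0 ≤ p ω)
    (hX : X.FactorsThrough S) : condEntropy p Y S = ∑ x, law p X x * rowEntropy W x := by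
  rw [condEntropy_eq_sum]
  have key : ∀ ω, p ω * Real.logb 2 (law p (fun ω => (Y ω, S ω)) (Y ω, S ω) / law p S (S ω)) =
      p ω * Real.logb 2 (W (X ω) (Y ω)) := by
    intro ω
    rcases (hp ω).eq_or_lt with h0 | h0
    · simp [← h0]
    · have h1 : law p (fun ω => (Y ω, S ω)) (Y ω, S ω) = law p S (S ω) * W (X ω) (Y ω) := by
        rw [law_congr p (X := S) (a := S ω) (Y := fun ω => (S ω, X ω)) (b := (S ω, X ω))
          fun ω' => by simpa using fun hs => hX hs, ← h]
        refine law_congr p fun ω' => ?_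
        simp only [Prod.mk.injEq]
        exact ⟨fun hh => ⟨hh.2, hX hh.2, hh.1⟩, fun hh => ⟨hh.2.2, hh.1⟩⟩
      rw [h1, mul_div_cancel_left₀ _ (law_pos hp S h0).ne']
  simp_rw [key]
  rw [← sum_law_mul p (fun ω => (X ω, Y ω)) fun xy => Real.logb 2 (W xy.1 xy.2),
    Fintype.sum_prod_type, ← Finset.sum_neg_distrib]
  refine Finset.sum_congr rfl fun x _ => ?_
  simp only [h.law_input_output, rowEntropy, Finset.mul_sum, mul_neg, mul_assoc]

end ChannelLaw

end Channel

/-! ### Convex hulls of graphs -/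

section Hull

open scoped Pointwise

/-- In a finite-dimensional space, the convex hull of a compact set is compact. -/
lemma IsCompact.convexHull_of_finiteDimensional {E : Type*} [NormedAddCommGroup E]
    [NormedSpace ℝ E] [FiniteDimensional ℝ E] {s : Set E} (hs : IsCompact s) :
    IsCompact (convexHull ℝ s) := by
  -- Carathéodory: affinely independent points number at most the dimension plus one, so the hull is
  -- a finite union of continuous images of compact sets.
  have hcover : convexHull ℝ s = ⋃ k ∈ Finset.range (Module.finrank ℝ E + 2),
      (fun wz : (Fin k → ℝ) × (Fin k → E) => ∑ i, wz.1 i • wz.2 i) ''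
        (stdSimplex ℝ (Fin k) ×ˢ Set.pi Set.univ fun _ => s) := by
    refine Set.Subset.antisymm (fun x hx => ?_) ?_
    · obtain ⟨ι, hι, z, w, hz, hind, hw, hw1, rfl⟩ := eq_pos_convex_span_of_mem_convexHull hx
      refine Set.mem_biUnion (x := Fintype.card ι)
        (Finset.mem_coe.2 (Finset.mem_range.2 (Nat.lt_succ_of_le
          (hind.card_le_finrank_succ.trans (Nat.succ_le_succ (Submodule.finrank_le _)))))) ?_
      refine ⟨(w ∘ (Fintype.equivFin ι).symm, z ∘ (Fintype.equivFin ι).symm), ⟨⟨?_, ?_⟩, ?_⟩, ?_⟩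
      · exact fun i => (hw _).le
      · simpa using (Equiv.sum_comp (Fintype.equivFin ι).symm w).trans hw1
      · exact fun i _ => hz ⟨_, rfl⟩
      · exact Equiv.sum_comp (Fintype.equivFin ι).symm fun i => w i • z i
    · refine Set.iUnion₂_subset fun k _ => ?_
      rintro _ ⟨⟨w, z⟩, ⟨hw, hz⟩, rfl⟩
      exact (convex_convexHull ℝ s).sum_mem (fun i _ => hw.1 i) hw.2
        fun i _ => subset_convexHull ℝ s (hz i trivial)
  rw [hcover]
  refine Finset.isCompact_biUnion _ fun k _ => IsCompact.image ?_ (by fun_prop)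
  exact (isCompact_stdSimplex ℝ _).prod (isCompact_univ_pi fun _ => hs)

/-- Rests on (a + b) • S = a • S + b • S for convex S and a, b ≥ 0; weights that may vanish never
have to be divided by. -/
lemma sum_mem_sum_smul {E ι : Type*} [AddCommGroup E] [Module ℝ E] {S : Set E} (hS : Convex ℝ S)
    (hne : S.Nonempty) (t : Finset ι) {m : ι → ℝ} {x : ι → E} (hm : ∀ i ∈ t, 0 ≤ m i)
    (hx : ∀ i ∈ t, x i ∈ m i • S) : ∑ i ∈ t, x i ∈ (∑ i ∈ t, m i) • S := by
  classical
  induction t using Finset.induction_on with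
  | empty => simp [Set.zero_smul_set hne]
  | insert a t ha ih =>
    rw [Finset.sum_insert ha, Finset.sum_insert ha,
      hS.add_smul (hm a (by simp)) (Finset.sum_nonneg fun i hi => hm i (by simp [hi]))]
    exact Set.add_mem_add (hx a (by simp)) (ih (fun i hi => hm i (by simp [hi]))
      fun i hi => hx i (by simp [hi]))

/-- Finitely many points of a convex hull are convex combinations of common points. -/
lemma exists_common_weights {ι E : Type*} [Finite ι] [AddCommGroup E] [Module ℝ E] {A : Set E}
    (x : ι → E) (hx : ∀ i, x i ∈ convexHull ℝ A) :
    ∃ (d : ℕ) (pt : Fin d → E) (q : ι → Fin d → ℝ), (∀ j, pt j ∈ A) ∧ IsCondPMF q ∧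
      ∀ i, x i = ∑ j, q i j • pt j := by
  classical
  have := Fintype.ofFinite ι
  have h : ∀ i, ∃ t : Finset E, (t : Set E) ⊆ A ∧ x i ∈ convexHull ℝ (t : Set E) := by
    intro i
    have := hx i
    rw [convexHull_eq_union_convexHull_finite_subsets] at this
    simpa using this
  choose t ht hxt using h
  let T := Finset.univ.biUnion t
  have hw : ∀ i, ∃ w : E → ℝ, (∀ y ∈ T, 0 ≤ w y) ∧ ∑ y ∈ T, w y = 1 ∧ ∑ y ∈ T, w y • y = x i :=
    fun i => Finset.mem_convexHull'.1 (convexHull_mono (by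
      exact_mod_cast Finset.subset_biUnion_of_mem t (Finset.mem_univ i)) (hxt i))
  choose w hw0 hw1 hwx using hw
  let e := T.equivFin
  refine ⟨_, fun j => e.symm j, fun i j => w i (e.symm j), fun j => ?_, fun i => ⟨fun j => ?_, ?_⟩,
    fun i => ?_⟩
  · obtain ⟨i, -, hi⟩ := Finset.mem_biUnion.1 (e.symm j).2
    exact ht i hi
  · exact hw0 i _ (e.symm j).2
  · exact (Equiv.sum_comp e.symm fun y : T => w i y).trans ((Finset.sum_coe_sort T _).trans (hw1 i))
  · rw [← hwx i]
    exact ((Equiv.sum_comp e.symm fun y : T => w i y • (y : E)).trans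
      (Finset.sum_coe_sort T fun y => w i y • y)).symm

lemma prodMk_sum {ι E F : Type*} [AddCommMonoid E] [AddCommMonoid F] (s : Finset ι) (f : ι → E)
    (g : ι → F) : (∑ i ∈ s, f i, ∑ i ∈ s, g i) = ∑ i ∈ s, (f i, g i) :=
  Prod.ext (by rw [Prod.fst_sum]) (by rw [Prod.snd_sum])

/-- The convex hull of the graph of `hs ∘ pr` over `T`. -/
def graphHull {P E G : Type*} [AddCommGroup E] [Module ℝ E] [AddCommGroup G] [Module ℝ G]
    (pr : E → P) (hs : P → G) (T : Set E) : Set (E × G) :=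
  convexHull ℝ ((fun e => (e, hs (pr e))) '' T)

section

variable {P E G : Type*} [AddCommGroup P] [Module ℝ P] [AddCommGroup E] [Module ℝ E]
  [AddCommGroup G] [Module ℝ G] {pr : E →ₗ[ℝ] P} {hs : P → G} {T : Set E}

lemma fst_mem_of_mem_graphHull (hT : Convex ℝ T) {f : E × G} (hf : f ∈ graphHull pr hs T) :
    f.1 ∈ T := by
  have : graphHull pr hs T ⊆ Prod.fst ⁻¹' T :=
    convexHull_min (by rintro _ ⟨e, he, rfl⟩; exact he)
      (hT.is_linear_preimage (LinearMap.fst ℝ E G).isLinear)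
  exact this hf

lemma convex_graphHull : Convex ℝ (graphHull pr hs T) := convex_convexHull ℝ _

lemma graphHull_nonempty (hT : T.Nonempty) : (graphHull pr hs T).Nonempty :=
  (hT.image _).convexHull

/-- One layer of the nested hulls: homogeneity of `hs` lets each `x i` stay unnormalized, with `m i`
as its mass. The conclusion has the form of the hypothesis on `x`, so the lemma iterates. -/
lemma sum_mem_smul_graphHull {ι : Type*} (hne : T.Nonempty)
    (hhs : ∀ (t : ℝ) π, hs (t • π) = t • hs π) (s : Finset ι) {m : ι → ℝ}
    (hm : ∀ i ∈ s, 0 ≤ m i) {x : ι → E} (hx : ∀ i ∈ s, x i ∈ m i • T) :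
    (∑ i ∈ s, x i, ∑ i ∈ s, hs (pr (x i))) ∈ (∑ i ∈ s, m i) • graphHull pr hs T := by
  rw [prodMk_sum]
  refine sum_mem_sum_smul convex_graphHull (graphHull_nonempty hne) s hm fun i hi => ?_
  obtain ⟨e, he, hxe⟩ := hx i hi
  refine ⟨(e, hs (pr e)), subset_convexHull ℝ _ ⟨e, he, rfl⟩, ?_⟩
  rw [← hxe]
  simp [hhs]

/-- The weights become a transition kernel with index i as input. Having the same points for all i
is what makes the unfolded variables a Markov chain. -/
lemma exists_weights_of_mem_graphHull {ι : Type*} [Finite ι] (x : ι → E × G)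
    (hx : ∀ i, x i ∈ graphHull pr hs T) :
    ∃ (d : ℕ) (pt : Fin d → E) (q : ι → Fin d → ℝ), (∀ j, pt j ∈ T) ∧ IsCondPMF q ∧
      ∀ i, (x i).1 = ∑ j, q i j • pt j ∧ (x i).2 = ∑ j, q i j • hs (pr (pt j)) := by
  obtain ⟨d, pt, q, hpt, hq, h⟩ := exists_common_weights x hx
  choose pt' hpt' hpe using hpt
  refine ⟨d, pt', q, hpt', hq, fun i => ?_⟩
  rw [h i]
  simp [← hpe, Prod.fst_sum, Prod.snd_sum]

end

lemma isCompact_graphHull {P E G : Type*} [TopologicalSpace P]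
    [NormedAddCommGroup E] [NormedSpace ℝ E] [FiniteDimensional ℝ E]
    [NormedAddCommGroup G] [NormedSpace ℝ G] [FiniteDimensional ℝ G]
    {pr : E → P} (hpr : Continuous pr) {hs : P → G} {D : Set P} (hcont : ContinuousOn hs D)
    {T : Set E} (hT : IsCompact T) (hTD : Set.MapsTo pr T D) : IsCompact (graphHull pr hs T) :=
  (hT.image_of_continuousOn (continuousOn_id.prodMk
    (hcont.comp hpr.continuousOn hTD))).convexHull_of_finiteDimensional

end Hull

/-! ### Mutual information through output entropies, and composition of channels -/

section MutualInfo

variable {Ω α β γ σ τ : Type*} [Fintype Ω] [Fintype α] [Fintype β] [Fintype γ] [Fintype σ]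
  [Fintype τ] {p : Ω → ℝ}

lemma mutualInfo_eq (hp : ∀ ω, 0 ≤ p ω) (X : Ω → α) (Y : Ω → β) :
    mutualInfo p X Y = entropy p Y - condEntropy p Y X := by
  rw [mutualInfo, condEntropy_eq hp, condEntropy_eq hp,
    entropy_congr p (X := fun ω => (X ω, Y ω)) (Y := fun ω => (Y ω, X ω)) fun ω ω' => by
      simp [and_comm]]
  ring

lemma condMutualInfo_eq (hp : ∀ ω, 0 ≤ p ω) (X : Ω → α) (Y : Ω → β) (Z : Ω → γ) :
    condMutualInfo p X Y Z = condEntropy p Y Z - condEntropy p Y (fun ω => (X ω, Z ω)) := by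
  rw [condMutualInfo, condEntropy_eq hp, condEntropy_eq hp, condEntropy_eq hp, condEntropy_eq hp,
    entropy_congr p (X := fun ω => (X ω, Y ω, Z ω)) (Y := fun ω => (Y ω, X ω, Z ω)) fun ω ω' => by
      simp; tauto]
  ring

namespace ChannelLaw

lemma pair_input {σ α β : Type*} {S : Ω → σ} {X : Ω → α} {Y : Ω → β} {W : α → β → ℝ}
    (h : ChannelLaw p S X Y W) : ChannelLaw p (fun ω => (X ω, S ω)) X Y W := by
  rintro ⟨x', s⟩ x y
  rcases eq_or_ne x' x with rfl | hx
  · refine Eq.trans ?_ ((h s x' y).trans (congrArg (· * _) ?_))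
    · exact law_congr p fun ω => by simp only [Prod.mk.injEq]; tauto
    · exact law_congr p fun ω => by simp only [Prod.mk.injEq]; tauto
  · have h1 : ∀ ω, ((X ω, S ω), X ω, Y ω) ≠ ((x', s), x, y) := fun ω hω => by
      simp only [Prod.mk.injEq] at hω
      exact hx (hω.1.1.symm.trans hω.2.1)
    have h2 : ∀ ω, ((X ω, S ω), X ω) ≠ ((x', s), x) := fun ω hω => by
      simp only [Prod.mk.injEq] at hω
      exact hx (hω.1.1.symm.trans hω.2)
    simp [law, h1, h2]

/-- Conditional output entropy when the channel input is itself the output of a channel. -/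
lemma condEntropy_eq_sum_of_input {S : Ω → σ} {X : Ω → α} {Y : Ω → β} {W : α → β → ℝ}
    (h : ChannelLaw p S X Y W) {S' : Ω → τ} {A : Ω → γ} {κ : γ → α → ℝ}
    (h' : ChannelLaw p S' A X κ) (hS : (fun ω => (S' ω, A ω)).FactorsThrough S) :
    condEntropy p Y (fun ω => (S' ω, A ω)) = ∑ a, law p A a * outputEntropy W (κ a) := by
  rw [(h.of_factorsThrough hS).condEntropy_eq_sum_outputEntropy]
  have : ∀ sa : τ × γ, (outputEntropy W fun x => law p (fun ω => ((S' ω, A ω), X ω)) (sa, x)) =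
      law p (fun ω => (S' ω, A ω)) sa * outputEntropy W (κ sa.2) := by
    rintro ⟨s, a⟩
    rw [← outputEntropy_smul]
    congr 1
    funext x
    rw [Pi.smul_apply, smul_eq_mul, ← h']
    exact law_congr p fun ω => by simp [and_assoc]
  simp_rw [this]
  rw [sum_law_mul p (fun ω => (S' ω, A ω)) fun sa => outputEntropy W (κ sa.2),
    sum_law_mul p A fun a => outputEntropy W (κ a)]

lemma condEntropy_eq_sum_of_input' {S : Ω → σ} {X : Ω → α} {Y : Ω → β} {W : α → β → ℝ}
    (h : ChannelLaw p S X Y W) (hp : ∀ ω, 0 ≤ p ω) {S' : Ω → τ} {A : Ω → γ} {κ : γ → α → ℝ}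
    (h' : ChannelLaw p S' A X κ) (hS : A.FactorsThrough S) :
    condEntropy p Y A = ∑ a, law p A a * outputEntropy W (κ a) := by
  rw [← h.condEntropy_eq_sum_of_input (h'.of_factorsThrough (S' := fun _ => ()) fun _ _ _ => rfl)
    fun ω ω' hω => by simpa using hS hω]
  exact condEntropy_congr hp (by simp) (by simp)

/-- Chapman–Kolmogorov: sum the joint law over the intermediate letter b. -/
lemma comp {σ α γ : Type*} {S : Ω → σ} {A : Ω → α} {B : Ω → β} {C : Ω → γ} {κ : α → β → ℝ}
    {κ' : β → γ → ℝ} (h : ChannelLaw p S A B κ) (h' : ChannelLaw p (fun ω => (S ω, A ω)) B C κ') :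
    ChannelLaw p S A C fun a c => ∑ b, κ a b * κ' b c := by
  intro s a c
  rw [← sum_law_pair_left p B, Finset.mul_sum]
  refine Finset.sum_congr rfl fun b _ => ?_
  rw [← mul_assoc, ← h]
  refine Eq.trans ?_ ((h' (s, a) b c).trans (congrArg (· * _) ?_))
  · exact law_congr p fun ω => by simp only [Prod.mk.injEq]; tauto
  · exact law_congr p fun ω => by simp only [Prod.mk.injEq]; tauto

end ChannelLaw

end MutualInfo

/-! ### Profiles of auxiliary chains: compactness and the closed single-letter region -/

section Profile

variable {𝒳 𝒴₁ 𝒵₂ 𝒵₃ : Type*} [Fintype 𝒳] [Fintype 𝒴₁] [Fintype 𝒵₂] [Fintype 𝒵₃]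

namespace BroadcastChannel

/-- The channel to the first receiver. -/
def W₁ {𝒳 : Type*} (ch : BroadcastChannel 𝒳 𝒴₁ 𝒵₂ 𝒵₃) (x : 𝒳) : 𝒴₁ → ℝ :=
  law (ch.W x) fun y => y.1

/-- The channel to the second receiver. -/
def W₂ {𝒳 : Type*} (ch : BroadcastChannel 𝒳 𝒴₁ 𝒵₂ 𝒵₃) (x : 𝒳) : 𝒵₂ → ℝ :=
  law (ch.W x) fun y => y.2.1

/-- The channel to the third receiver. -/
def W₃ {𝒳 : Type*} (ch : BroadcastChannel 𝒳 𝒴₁ 𝒵₂ 𝒵₃) (x : 𝒳) : 𝒵₃ → ℝ :=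
  law (ch.W x) fun y => y.2.2

/-- The three output entropies for an unnormalized input distribution. -/
def outputEntropies (ch : BroadcastChannel 𝒳 𝒴₁ 𝒵₂ 𝒵₃) (π : 𝒳 → ℝ) : ℝ × ℝ × ℝ :=
  (outputEntropy ch.W₁ π, outputEntropy ch.W₂ π, outputEntropy ch.W₃ π)

lemma outputEntropies_smul (ch : BroadcastChannel 𝒳 𝒴₁ 𝒵₂ 𝒵₃) (t : ℝ) (π : 𝒳 → ℝ) :
    ch.outputEntropies (t • π) = t • ch.outputEntropies π := by
  simp [outputEntropies, outputEntropy_smul]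

lemma continuousOn_outputEntropies (ch : BroadcastChannel 𝒳 𝒴₁ 𝒵₂ 𝒵₃) :
    ContinuousOn ch.outputEntropies (stdSimplex ℝ 𝒳) :=
  (continuousOn_outputEntropy _).prodMk
    ((continuousOn_outputEntropy _).prodMk (continuousOn_outputEntropy _))

/-- The pairs of an input pmf and the output entropies given `V`. -/
def profiles₁ (ch : BroadcastChannel 𝒳 𝒴₁ 𝒵₂ 𝒵₃) : Set ((𝒳 → ℝ) × ℝ × ℝ × ℝ) :=
  graphHull (LinearMap.id : (𝒳 → ℝ) →ₗ[ℝ] 𝒳 → ℝ) ch.outputEntropies (stdSimplex ℝ 𝒳)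

/-- The input pmfs with the output entropies given `V` and given `U₃`. -/
def profiles₂ (ch : BroadcastChannel 𝒳 𝒴₁ 𝒵₂ 𝒵₃) :
    Set (((𝒳 → ℝ) × ℝ × ℝ × ℝ) × ℝ × ℝ × ℝ) :=
  graphHull (LinearMap.fst ℝ (𝒳 → ℝ) (ℝ × ℝ × ℝ)) ch.outputEntropies ch.profiles₁

/-- The input pmfs with the output entropies given `V`, given `U₃` and given `U`. -/
def profiles₃ (ch : BroadcastChannel 𝒳 𝒴₁ 𝒵₂ 𝒵₃) :
    Set ((((𝒳 → ℝ) × ℝ × ℝ × ℝ) × ℝ × ℝ × ℝ) × ℝ × ℝ × ℝ) :=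
  graphHull (LinearMap.fst ℝ (𝒳 → ℝ) (ℝ × ℝ × ℝ) ∘ₗ
    LinearMap.fst ℝ ((𝒳 → ℝ) × ℝ × ℝ × ℝ) (ℝ × ℝ × ℝ)) ch.outputEntropies ch.profiles₂

/-- The single-letter inequalities, without positive parts, in terms of a profile. -/
def ProfileInequalities (ch : BroadcastChannel 𝒳 𝒴₁ 𝒵₂ 𝒵₃)
    (f : (((𝒳 → ℝ) × ℝ × ℝ × ℝ) × ℝ × ℝ × ℝ) × ℝ × ℝ × ℝ) (R : ℝ × ℝ × ℝ × ℝ) : Prop :=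
  R.1 ≤ outputEntropy ch.W₂ f.1.1.1 - f.2.2.1 ∧
  R.1 ≤ outputEntropy ch.W₃ f.1.1.1 - f.1.2.2.2 ∧
  R.2.1 ≤ f.2.1 - f.1.1.2.1 ∧
  R.1 + R.2.1 ≤ outputEntropy ch.W₃ f.1.1.1 - f.1.2.2.2 + f.1.2.1 - f.1.1.2.1 ∧
  R.2.2.1 ≤ f.2.1 - f.2.2.1 -
    ∑ x, f.1.1.1 x * (rowEntropy ch.W₁ x - rowEntropy ch.W₂ x) ∧
  R.1 + R.2.2.1 ≤ outputEntropy ch.W₃ f.1.1.1 - f.1.2.2.2 + f.1.2.1 - f.2.2.1 -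
    ∑ x, f.1.1.1 x * (rowEntropy ch.W₁ x - rowEntropy ch.W₂ x) ∧
  R.2.2.2 ≤ f.1.2.1 - f.1.1.2.1 - f.1.2.2.2 + f.1.1.2.2.2

variable (ch : BroadcastChannel 𝒳 𝒴₁ 𝒵₂ 𝒵₃)

lemma fst_mem_of_mem_profiles₁ {f} (hf : f ∈ ch.profiles₁) : f.1 ∈ stdSimplex ℝ 𝒳 :=
  fst_mem_of_mem_graphHull (convex_stdSimplex ℝ 𝒳) hf

lemma fst_mem_of_mem_profiles₂ {f} (hf : f ∈ ch.profiles₂) : f.1 ∈ ch.profiles₁ :=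
  fst_mem_of_mem_graphHull convex_graphHull hf

lemma fst_mem_of_mem_profiles₃ {f} (hf : f ∈ ch.profiles₃) : f.1 ∈ ch.profiles₂ :=
  fst_mem_of_mem_graphHull convex_graphHull hf

lemma isCompact_profiles₃ : IsCompact ch.profiles₃ := by
  have h1 : IsCompact ch.profiles₁ :=
    isCompact_graphHull (LinearMap.continuous_of_finiteDimensional _)
      ch.continuousOn_outputEntropies (isCompact_stdSimplex ℝ 𝒳) fun f hf => hf
  have h2 : IsCompact ch.profiles₂ :=
    isCompact_graphHull (LinearMap.continuous_of_finiteDimensional _)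
      ch.continuousOn_outputEntropies h1 fun f hf => ch.fst_mem_of_mem_profiles₁ hf
  exact isCompact_graphHull (LinearMap.continuous_of_finiteDimensional _)
      ch.continuousOn_outputEntropies h2 fun f hf =>
        ch.fst_mem_of_mem_profiles₁ (ch.fst_mem_of_mem_profiles₂ hf)

/-- Projection along a compact factor is a closed map. Profiles are taken as a subtype because the
output entropies are only known to be continuous on the simplex. -/
lemma isClosed_profileRegion :
    IsClosed {R : ℝ × ℝ × ℝ × ℝ | ∃ f ∈ ch.profiles₃, ch.ProfileInequalities f R} := by
  have : CompactSpace ch.profiles₃ := isCompact_iff_compactSpace.1 ch.isCompact_profiles₃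
  have hc : Continuous fun f : ch.profiles₃ => ch.outputEntropies f.1.1.1.1 :=
    ch.continuousOn_outputEntropies.comp_continuous (by fun_prop) fun f =>
      ch.fst_mem_of_mem_profiles₁ (ch.fst_mem_of_mem_profiles₂ (ch.fst_mem_of_mem_profiles₃ f.2))
  have hc2 : Continuous fun g : ch.profiles₃ × ℝ × ℝ × ℝ × ℝ =>
    outputEntropy ch.W₂ g.1.1.1.1.1 := hc.snd.fst.comp continuous_fst
  have hc3 : Continuous fun g : ch.profiles₃ × ℝ × ℝ × ℝ × ℝ =>
    outputEntropy ch.W₃ g.1.1.1.1.1 := hc.snd.snd.comp continuous_fst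
  have hcl : IsClosed {g : ch.profiles₃ × ℝ × ℝ × ℝ × ℝ | ch.ProfileInequalities g.1 g.2} := by
    refine IsClosed.and (isClosed_le ?_ ?_) <| IsClosed.and (isClosed_le ?_ ?_) <|
      IsClosed.and (isClosed_le ?_ ?_) <| IsClosed.and (isClosed_le ?_ ?_) <|
      IsClosed.and (isClosed_le ?_ ?_) <| IsClosed.and (isClosed_le ?_ ?_) (isClosed_le ?_ ?_)
    all_goals fun_prop
  convert isClosedMap_snd_of_compactSpace _ hcl using 1
  ext R
  constructor
  · rintro ⟨f, hf, h⟩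
    exact ⟨(⟨f, hf⟩, R), h, rfl⟩
  · rintro ⟨⟨f, R⟩, h, rfl⟩
    exact ⟨f.1, f.2, h⟩

end BroadcastChannel

end Profile

/-! ### Correspondence between profiles and finite auxiliary random variables -/

section AuxPMF

variable {𝒳 𝒴₁ 𝒵₂ 𝒵₃ 𝒰 𝒰₃ 𝒱 : Type*} [Fintype 𝒳] [Fintype 𝒴₁] [Fintype 𝒵₂] [Fintype 𝒵₃]
  [Fintype 𝒰] [Fintype 𝒰₃] [Fintype 𝒱]

open scoped Pointwise

lemma mem_sum_smul_stdSimplex [Nonempty 𝒳] {π : 𝒳 → ℝ} (hπ : ∀ x, 0 ≤ π x) :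
    π ∈ (∑ x, π x) • stdSimplex ℝ 𝒳 := by
  classical
  rcases eq_or_ne (∑ x, π x) 0 with h | h
  · have h0 : π = 0 := by
      funext x
      exact (Finset.sum_eq_zero_iff_of_nonneg fun x _ => hπ x).1 h x (Finset.mem_univ x)
    rw [h, h0, Set.zero_smul_set ⟨_, single_mem_stdSimplex ℝ (Classical.arbitrary 𝒳)⟩]
    rfl
  · refine ⟨(∑ x, π x)⁻¹ • π, ⟨fun x => ?_, ?_⟩, ?_⟩
    · exact mul_nonneg (inv_nonneg.2 (Finset.sum_nonneg fun x _ => hπ x)) (hπ x)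
    · simp [← Finset.mul_sum, h]
    · simp [smul_smul, h]

namespace BroadcastChannel

/-- The output entropies of a broadcast channel given `S`. -/
def condOutputEntropies {Ω σ : Type*} [Fintype Ω] [Fintype σ] (p : Ω → ℝ)
    (Y : Ω → 𝒴₁ × 𝒵₂ × 𝒵₃) (S : Ω → σ) : ℝ × ℝ × ℝ :=
  (condEntropy p (fun ω => (Y ω).1) S, condEntropy p (fun ω => (Y ω).2.1) S,
    condEntropy p (fun ω => (Y ω).2.2) S)

lemma condOutputEntropies_eq_sum {Ω σ : Type*} [Fintype Ω] [Fintype σ] {p : Ω → ℝ}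
    {S : Ω → σ} {X : Ω → 𝒳} {Y : Ω → 𝒴₁ × 𝒵₂ × 𝒵₃} (ch : BroadcastChannel 𝒳 𝒴₁ 𝒵₂ 𝒵₃)
    (h : ChannelLaw p S X Y ch.W) :
    condOutputEntropies p Y S =
      ∑ s, ch.outputEntropies fun x => law p (fun ω => (S ω, X ω)) (s, x) := by
  unfold condOutputEntropies outputEntropies
  rw [(h.map_output fun y => y.1).condEntropy_eq_sum_outputEntropy,
    (h.map_output fun y => y.2.1).condEntropy_eq_sum_outputEntropy,
    (h.map_output fun y => y.2.2).condEntropy_eq_sum_outputEntropy]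
  refine Prod.ext ?_ (Prod.ext ?_ ?_)
  · rw [Prod.fst_sum]; rfl
  · rw [Prod.snd_sum, Prod.fst_sum]; rfl
  · rw [Prod.snd_sum, Prod.snd_sum]; rfl

/-- Work from the inside out with unnormalized slices: summing over v gives a point of `profiles₁`
scaled by the mass of (u, t), summing over t a scaled point of `profiles₂`, summing over u a point
of `profiles₃`, the total mass being 1. -/
lemma profile_mem {Ω : Type*} [Fintype Ω] {p : Ω → ℝ} (hp : ∀ ω, 0 ≤ p ω) (hp1 : ∑ ω, p ω = 1)
    {U : Ω → 𝒰} {T : Ω → 𝒰₃} {V : Ω → 𝒱} {X : Ω → 𝒳} {Y : Ω → 𝒴₁ × 𝒵₂ × 𝒵₃}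
    (ch : BroadcastChannel 𝒳 𝒴₁ 𝒵₂ 𝒵₃)
    (h : ChannelLaw p (fun ω => ((U ω, T ω), V ω)) X Y ch.W) :
    (((law p X, condOutputEntropies p Y fun ω => ((U ω, T ω), V ω)),
      condOutputEntropies p Y fun ω => (U ω, T ω)), condOutputEntropies p Y U) ∈
      ch.profiles₃ := by
  have : Nonempty 𝒳 := by
    by_contra h𝒳
    have := not_nonempty_iff.1 h𝒳
    have : IsEmpty Ω := ⟨fun ω => isEmptyElim (X ω)⟩
    simp at hp1
  have hne0 : (stdSimplex ℝ 𝒳).Nonempty := by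
    classical
    exact ⟨_, single_mem_stdSimplex ℝ (Classical.arbitrary 𝒳)⟩
  have h2 : ChannelLaw p (fun ω => (U ω, T ω)) X Y ch.W :=
    h.of_factorsThrough fun ω ω' hω => (congrArg Prod.fst hω :)
  have h1 : ChannelLaw p U X Y ch.W :=
    h2.of_factorsThrough fun ω ω' hω => (congrArg Prod.fst hω :)
  rw [condOutputEntropies_eq_sum ch h, condOutputEntropies_eq_sum ch h2,
    condOutputEntropies_eq_sum ch h1, Fintype.sum_prod_type, Fintype.sum_prod_type,
    Fintype.sum_prod_type]
  set r : 𝒰 → 𝒰₃ → 𝒱 → 𝒳 → ℝ := fun u t v x =>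
    law p (fun ω => (((U ω, T ω), V ω), X ω)) (((u, t), v), x) with hr
  have hr0 : ∀ u t v x, 0 ≤ r u t v x := fun u t v x => law_nonneg hp _ _
  have e2 : ∀ u t, (fun x => law p (fun ω => ((U ω, T ω), X ω)) ((u, t), x)) = ∑ v, r u t v := by
    intro u t
    funext x
    rw [Finset.sum_apply, ← sum_law_pair_left p V]
    exact Finset.sum_congr rfl fun v _ => law_congr p fun ω => by
      simp only [Prod.mk.injEq]; tauto
  have e1 : ∀ u, (fun x => law p (fun ω => (U ω, X ω)) (u, x)) = ∑ t, ∑ v, r u t v := by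
    intro u
    funext x
    rw [Finset.sum_apply, ← sum_law_pair_left p T]
    refine Finset.sum_congr rfl fun t _ => ?_
    rw [← e2]
    exact law_congr p fun ω => by simp only [Prod.mk.injEq]; tauto
  have e0 : law p X = ∑ u, ∑ t, ∑ v, r u t v := by
    funext x
    rw [Finset.sum_apply, ← sum_law_pair_left p U]
    refine Finset.sum_congr rfl fun u _ => ?_
    rw [← e1]
  simp_rw [e2, e1, e0]
  have k1 : ∀ u t, (∑ v, r u t v, ∑ v, ch.outputEntropies (r u t v)) ∈
      (∑ v, ∑ x, r u t v x) • ch.profiles₁ := fun u t =>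
    sum_mem_smul_graphHull (pr := (LinearMap.id : (𝒳 → ℝ) →ₗ[ℝ] 𝒳 → ℝ)) hne0
      ch.outputEntropies_smul _ (fun v _ => Finset.sum_nonneg fun x _ => hr0 _ _ _ _)
      fun v _ => mem_sum_smul_stdSimplex (hr0 u t v)
  have k2 : ∀ u, ((∑ t, ∑ v, r u t v, ∑ t, ∑ v, ch.outputEntropies (r u t v)),
      ∑ t, ch.outputEntropies (∑ v, r u t v)) ∈
      (∑ t, ∑ v, ∑ x, r u t v x) • ch.profiles₂ := by
    intro u
    have := sum_mem_smul_graphHull (pr := LinearMap.fst ℝ (𝒳 → ℝ) (ℝ × ℝ × ℝ))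
      (graphHull_nonempty hne0) ch.outputEntropies_smul Finset.univ
      (fun t _ => Finset.sum_nonneg fun v _ => Finset.sum_nonneg fun x _ => hr0 _ _ _ _)
      (fun t _ => k1 u t)
    rw [prodMk_sum]
    exact this
  have k3 := sum_mem_smul_graphHull (pr := LinearMap.fst ℝ (𝒳 → ℝ) (ℝ × ℝ × ℝ) ∘ₗ
      LinearMap.fst ℝ ((𝒳 → ℝ) × ℝ × ℝ × ℝ) (ℝ × ℝ × ℝ))
      (graphHull_nonempty (graphHull_nonempty hne0)) ch.outputEntropies_smul Finset.univ
      (fun u _ => Finset.sum_nonneg fun t _ => Finset.sum_nonneg fun v _ =>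
        Finset.sum_nonneg fun x _ => hr0 _ _ _ _)
      (fun u _ => k2 u)
  have hm : ∑ u, ∑ t, ∑ v, ∑ x, r u t v x = 1 := by
    rw [← hp1, ← sum_law p fun ω => (((U ω, T ω), V ω), X ω), Fintype.sum_prod_type,
      Fintype.sum_prod_type, Fintype.sum_prod_type]
  rw [hm, one_smul] at k3
  rw [prodMk_sum, prodMk_sum]
  exact k3

/-- By the Markov property only the last chain variable in the condition matters, so each
conditional entropy is an average of output entropies of the kernel from that variable to X, or of
row entropies when X itself is given. -/
lemma condEntropies_of_chain {Ω α β : Type*} [Fintype Ω] [Fintype α] [Fintype β] {p : Ω → ℝ}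
    (hp : ∀ ω, 0 ≤ p ω) (hp1 : ∑ ω, p ω = 1) {U : Ω → 𝒰} {U₃ : Ω → 𝒰₃} {V : Ω → 𝒱} {X : Ω → α}
    {Y : Ω → β} {W : α → β → ℝ} {pX : 𝒱 → α → ℝ} {κ₃ : 𝒰₃ → α → ℝ} {κ : 𝒰 → α → ℝ}
    (hY : ChannelLaw p (fun ω => ((U ω, U₃ ω), V ω)) X Y W)
    (hVX : ChannelLaw p (fun ω => (U ω, U₃ ω)) V X pX) (hU₃X : ChannelLaw p U U₃ X κ₃)
    (hUX : ChannelLaw p (fun _ => ()) U X κ) :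
    entropy p Y = outputEntropy W (law p X) ∧
    condEntropy p Y U = ∑ u, law p U u * outputEntropy W (κ u) ∧
    condEntropy p Y U₃ = ∑ u₃, law p U₃ u₃ * outputEntropy W (κ₃ u₃) ∧
    condEntropy p Y (fun ω => (U₃ ω, U ω)) = ∑ u₃, law p U₃ u₃ * outputEntropy W (κ₃ u₃) ∧
    condEntropy p Y (fun ω => (V ω, U ω)) = ∑ v, law p V v * outputEntropy W (pX v) ∧
    condEntropy p Y (fun ω => (V ω, U₃ ω)) = ∑ v, law p V v * outputEntropy W (pX v) ∧
    condEntropy p Y (fun ω => (X ω, U ω)) = ∑ x, law p X x * rowEntropy W x ∧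
    condEntropy p Y (fun ω => (X ω, U₃ ω)) = ∑ x, law p X x * rowEntropy W x := by
  have fU : U.FactorsThrough fun ω => ((U ω, U₃ ω), V ω) :=
    fun ω ω' h => (congrArg (fun t => t.1.1) h :)
  have fU₃ : U₃.FactorsThrough fun ω => ((U ω, U₃ ω), V ω) :=
    fun ω ω' h => (congrArg (fun t => t.1.2) h :)
  have fV : V.FactorsThrough fun ω => ((U ω, U₃ ω), V ω) :=
    fun ω ω' h => (congrArg (fun t => t.2) h :)
  refine ⟨hY.entropy_eq_outputEntropy hp hp1, hY.condEntropy_eq_sum_of_input' hp hUX fU,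
    hY.condEntropy_eq_sum_of_input' hp hU₃X fU₃, ?_, ?_, ?_, ?_, ?_⟩
  · rw [← hY.condEntropy_eq_sum_of_input hU₃X fun ω ω' h => Prod.ext (fU h) (fU₃ h)]
    exact condEntropy_congr hp (by simp; tauto) (by simp [and_comm])
  · rw [← hY.condEntropy_eq_sum_of_input (S' := U)
      (hVX.of_factorsThrough fun ω ω' h => (congrArg Prod.fst h :))
      fun ω ω' h => Prod.ext (fU h) (fV h)]
    exact condEntropy_congr hp (by simp; tauto) (by simp [and_comm])
  · rw [← hY.condEntropy_eq_sum_of_input (S' := U₃)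
      (hVX.of_factorsThrough fun ω ω' h => (congrArg Prod.snd h :))
      fun ω ω' h => Prod.ext (fU₃ h) (fV h)]
    exact condEntropy_congr hp (by simp; tauto) (by simp [and_comm])
  · exact (hY.of_factorsThrough fU).pair_input.condEntropy_eq_sum_rowEntropy hp
      fun ω ω' h => (congrArg Prod.fst h :)
  · exact (hY.of_factorsThrough fU₃).pair_input.condEntropy_eq_sum_rowEntropy hp
      fun ω ω' h => (congrArg Prod.fst h :)

/-- Profiles that satisfy the single-letter inequalities come from finite auxiliary random
variables. -/
lemma mem_outerBound_of_profile (ch : BroadcastChannel 𝒳 𝒴₁ 𝒵₂ 𝒵₃)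
    {f : (((𝒳 → ℝ) × ℝ × ℝ × ℝ) × ℝ × ℝ × ℝ) × ℝ × ℝ × ℝ} (hf : f ∈ ch.profiles₃)
    {R : ℝ × ℝ × ℝ × ℝ} (hR : ch.ProfileInequalities f R) : R ∈ outerBound ch := by
  -- The hulls are opened from the outside: f is an average of points e(u), their first components
  -- are averages of common points c(u₃), and those of the c(u₃) are averages of common input laws
  -- `pX v`.
  obtain ⟨a, e, pU', he, hpU', hfe⟩ := exists_weights_of_mem_graphHull (fun _ : Unit => f)
    fun _ => hf
  obtain ⟨b, c, pU₃, hc, hpU₃, hec⟩ := exists_weights_of_mem_graphHull e he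
  obtain ⟨d, pX, pV, hpX, hpV, hcX⟩ := exists_weights_of_mem_graphHull c hc
  set pU := pU' () with hpU_def
  have hpU : pU ∈ stdSimplex ℝ (Fin a) := hpU' ()
  obtain ⟨hf1, hf2⟩ := hfe ()
  refine ⟨a, b, d, pU, pU₃, pV, pX, hpU, hpU₃, hpV, hpX, ?_⟩
  set p := auxPMF ch pU pU₃ pV pX with hp_def
  have hp : ∀ ω, 0 ≤ p ω := by
    rintro ⟨u, u₃, v, x, y⟩
    exact mul_nonneg (mul_nonneg (mul_nonneg (mul_nonneg (hpU.1 u) ((hpU₃ u).1 u₃))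
      ((hpV u₃).1 v)) ((hpX v).1 x)) ((ch.isCondPMF x).1 y)
  let U : Fin a × Fin b × Fin d × 𝒳 × 𝒴₁ × 𝒵₂ × 𝒵₃ → Fin a := fun ω => ω.1
  let U₃ : Fin a × Fin b × Fin d × 𝒳 × 𝒴₁ × 𝒵₂ × 𝒵₃ → Fin b := fun ω => ω.2.1
  let V : Fin a × Fin b × Fin d × 𝒳 × 𝒴₁ × 𝒵₂ × 𝒵₃ → Fin d := fun ω => ω.2.2.1
  let X : Fin a × Fin b × Fin d × 𝒳 × 𝒴₁ × 𝒵₂ × 𝒵₃ → 𝒳 := fun ω => ω.2.2.2.1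
  let Y : Fin a × Fin b × Fin d × 𝒳 × 𝒴₁ × 𝒵₂ × 𝒵₃ → 𝒴₁ × 𝒵₂ × 𝒵₃ := fun ω => ω.2.2.2.2
  have l5 : ∀ u u₃ v x y, law p (fun ω => ((((U ω, U₃ ω), V ω), X ω), Y ω))
      ((((u, u₃), v), x), y) = p (u, u₃, v, x, y) := by
    intro u u₃ v x y
    unfold law
    rw [Finset.sum_eq_single (u, u₃, v, x, y)]
    · simp [U, U₃, V, X, Y]
    · rintro ⟨u', u₃', v', x', y'⟩ - h
      refine if_neg fun h' => h ?_
      simp only [Prod.mk.injEq, U, U₃, V, X, Y] at h' ⊢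
      tauto
    · simp
  have l4 : ∀ u u₃ v x, law p (fun ω => (((U ω, U₃ ω), V ω), X ω)) (((u, u₃), v), x) =
      pU u * pU₃ u u₃ * pV u₃ v * pX v x := by
    intro u u₃ v x
    rw [← sum_law_pair_right p _ Y]
    simp_rw [l5]
    simp only [hp_def, auxPMF, ← Finset.mul_sum, (ch.isCondPMF x).2, mul_one]
  have l3 : ∀ u u₃ v, law p (fun ω => ((U ω, U₃ ω), V ω)) ((u, u₃), v) =
      pU u * pU₃ u u₃ * pV u₃ v := by
    intro u u₃ v
    rw [← sum_law_pair_right p _ X]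
    simp_rw [l4]
    rw [← Finset.mul_sum, (hpX v).2, mul_one]
  have l2 : ∀ u u₃, law p (fun ω => (U ω, U₃ ω)) (u, u₃) = pU u * pU₃ u u₃ := by
    intro u u₃
    rw [← sum_law_pair_right p _ V]
    simp_rw [l3]
    rw [← Finset.mul_sum, (hpV u₃).2, mul_one]
  have l1 : ∀ u, law p U u = pU u := by
    intro u
    rw [← sum_law_pair_right p _ U₃]
    simp_rw [l2]
    rw [← Finset.mul_sum, (hpU₃ u).2, mul_one]
  have hp1 : ∑ ω, p ω = 1 := by
    rw [← sum_law p U]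
    simp_rw [l1]
    exact hpU.2
  have hY : ChannelLaw p (fun ω => ((U ω, U₃ ω), V ω)) X Y ch.W := by
    rintro ⟨⟨u, u₃⟩, v⟩ x y
    rw [l4, law_congr p (Y := fun ω => ((((U ω, U₃ ω), V ω), X ω), Y ω))
      (b := ((((u, u₃), v), x), y)) fun ω => by simp only [Prod.mk.injEq]; tauto, l5]
    rfl
  have hVX : ChannelLaw p (fun ω => (U ω, U₃ ω)) V X pX := by
    rintro ⟨u, u₃⟩ v x
    rw [l3, law_congr p (Y := fun ω => (((U ω, U₃ ω), V ω), X ω))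
      (b := (((u, u₃), v), x)) fun ω => by simp only [Prod.mk.injEq]; tauto, l4]
  have hU₃V : ChannelLaw p U U₃ V pV := by
    rintro u u₃ v
    rw [l2, law_congr p (Y := fun ω => ((U ω, U₃ ω), V ω))
      (b := ((u, u₃), v)) fun ω => by simp only [Prod.mk.injEq]; tauto, l3]
  have hUU₃ : ChannelLaw p (fun _ => ()) U U₃ pU₃ := by
    rintro ⟨⟩ u u₃
    rw [law_congr p (X := fun ω => ((), U ω)) (Y := U) (b := u) (by simp), l1,
      law_congr p (Y := fun ω => (U ω, U₃ ω)) (b := (u, u₃)) (by simp), l2]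
  have hκ₃ : ∀ u₃, (fun x => ∑ v, pV u₃ v * pX v x) = (c u₃).1 := by
    intro u₃
    rw [(hcX u₃).1]
    funext x
    simp
  have hU₃X : ChannelLaw p U U₃ X fun u₃ => (c u₃).1 := by
    simp_rw [← hκ₃]
    exact hU₃V.comp hVX
  have hκ : ∀ u, (fun x => ∑ u₃, pU₃ u u₃ * (c u₃).1 x) = (e u).1.1 := by
    intro u
    rw [(hec u).1]
    funext x
    simp [Prod.fst_sum]
  have hUX : ChannelLaw p (fun _ => ()) U X fun u => (e u).1.1 := by
    simp_rw [← hκ]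
    exact hUU₃.comp (hU₃X.of_factorsThrough fun ω ω' h => congrArg (Prod.mk ()) h)
  have hX : law p X = f.1.1.1 := by
    rw [hf1]
    funext x
    rw [← sum_law_pair_left p U]
    simp_rw [hUX.law_input_output, l1]
    simp [Prod.fst_sum, hpU_def]
  have lU₃ : ∀ u₃, law p U₃ u₃ = ∑ u, pU u * pU₃ u u₃ := fun u₃ => by
    rw [← sum_law_pair_left p U]
    simp_rw [l2]
  have lV : ∀ v, law p V v = ∑ u₃, (∑ u, pU u * pU₃ u u₃) * pV u₃ v := fun v => by
    rw [← sum_law_pair_left p U₃]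
    simp_rw [hU₃V.law_input_output, lU₃]
  -- The linear functional φ will select a receiver, so one computation per layer serves all three.
  have s2 : ∀ φ : ℝ × ℝ × ℝ →ₗ[ℝ] ℝ,
      ∑ u, law p U u * φ (ch.outputEntropies (e u).1.1) = φ f.2 := by
    intro φ
    rw [hf2, map_sum]
    simp [hpU_def, l1]
  have s12 : ∀ φ : ℝ × ℝ × ℝ →ₗ[ℝ] ℝ,
      ∑ u₃, law p U₃ u₃ * φ (ch.outputEntropies (c u₃).1) = φ f.1.2 := by
    intro φ
    simp_rw [lU₃, Finset.sum_mul]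
    rw [Finset.sum_comm, hf1, Prod.snd_sum, map_sum]
    refine Finset.sum_congr rfl fun u _ => ?_
    rw [Prod.smul_snd, (hec u).2, map_smul, map_sum, smul_eq_mul, Finset.mul_sum]
    simp [mul_assoc, hpU_def]
  have s112 : ∀ φ : ℝ × ℝ × ℝ →ₗ[ℝ] ℝ,
      ∑ v, law p V v * φ (ch.outputEntropies (pX v)) = φ f.1.1.2 := by
    intro φ
    have h3 : ∀ u₃, ∑ v, pV u₃ v * φ (ch.outputEntropies (pX v)) = φ (c u₃).2 := by
      intro u₃
      rw [(hcX u₃).2, map_sum]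
      simp
    have h2 : ∀ u, ∑ u₃, pU₃ u u₃ * φ (c u₃).2 = φ (e u).1.2 := by
      intro u
      rw [(hec u).1, Prod.snd_sum, map_sum]
      simp
    have h1 : ∑ u, pU u * φ (e u).1.2 = φ f.1.1.2 := by
      rw [hf1, Prod.fst_sum, Prod.snd_sum, map_sum]
      simp [hpU_def]
    simp_rw [lV, ← lU₃, Finset.sum_mul]
    rw [Finset.sum_comm, ← h1]
    simp_rw [mul_assoc, ← Finset.mul_sum, h3, lU₃, Finset.sum_mul]
    rw [Finset.sum_comm]
    simp_rw [mul_assoc, ← Finset.mul_sum, h2]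
  obtain ⟨-, a2, a3, a4, a5, a6, a7, a8⟩ := condEntropies_of_chain hp hp1
    (hY.map_output fun y => y.1) hVX hU₃X hUX
  obtain ⟨b1, b2, b3, b4, b5, b6, b7, b8⟩ := condEntropies_of_chain hp hp1
    (hY.map_output fun y => y.2.1) hVX hU₃X hUX
  obtain ⟨c1, -, c3, -, -, c6, -, -⟩ := condEntropies_of_chain hp hp1
    (hY.map_output fun y => y.2.2) hVX hU₃X hUX
  let φ₁ := LinearMap.fst ℝ ℝ (ℝ × ℝ)
  let φ₂ := LinearMap.fst ℝ ℝ ℝ ∘ₗ LinearMap.snd ℝ ℝ (ℝ × ℝ)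
  let φ₃ := LinearMap.snd ℝ ℝ ℝ ∘ₗ LinearMap.snd ℝ ℝ (ℝ × ℝ)
  replace a2 := a2.trans (s2 φ₁)
  replace a3 := a3.trans (s12 φ₁)
  replace a5 := a5.trans (s112 φ₁)
  replace a6 := a6.trans (s112 φ₁)
  replace b2 := b2.trans (s2 φ₂)
  replace b3 := b3.trans (s12 φ₂)
  replace b4 := b4.trans (s12 φ₂)
  replace c3 := c3.trans (s12 φ₃)
  replace c6 := c6.trans (s112 φ₃)
  rw [hX] at a7 a8 b1 b7 b8 c1
  simp only [ProfileInequalities, mul_sub, Finset.sum_sub_distrib] at hR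
  obtain ⟨h1, h2, h3, h4, h5, h6, h7⟩ := hR
  have i1 := mutualInfo_eq hp U fun ω => (Y ω).2.1
  have i2 := mutualInfo_eq hp U₃ fun ω => (Y ω).2.2
  have i3 := condMutualInfo_eq hp V (fun ω => (Y ω).1) U
  have i4 := condMutualInfo_eq hp V (fun ω => (Y ω).1) U₃
  have i5 := condMutualInfo_eq hp X (fun ω => (Y ω).1) U
  have i6 := condMutualInfo_eq hp X (fun ω => (Y ω).2.1) U
  have i7 := condMutualInfo_eq hp X (fun ω => (Y ω).1) U₃
  have i8 := condMutualInfo_eq hp X (fun ω => (Y ω).2.1) U₃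
  have i9 := condMutualInfo_eq hp U₃ (fun ω => (Y ω).2.1) U
  have i10 := condMutualInfo_eq hp V (fun ω => (Y ω).2.2) U₃
  rw [b1, b2] at i1
  rw [c1, c3] at i2
  rw [a2, a5] at i3
  rw [a3, a6] at i4
  rw [a2, a7] at i5
  rw [b2, b7] at i6
  rw [a3, a8] at i7
  rw [b3, b8] at i8
  rw [b2, b4] at i9
  rw [c3, c6] at i10
  set E₁ := ∑ x, f.1.1.1 x * rowEntropy ch.W₁ x
  set E₂ := ∑ x, f.1.1.1 x * rowEntropy ch.W₂ x
  have hgoal : R.1 ≤ min (mutualInfo p U fun ω => (Y ω).2.1)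
        (mutualInfo p U₃ fun ω => (Y ω).2.2) ∧
      R.2.1 ≤ condMutualInfo p V (fun ω => (Y ω).1) U ∧
      R.1 + R.2.1 ≤ mutualInfo p U₃ (fun ω => (Y ω).2.2) +
        condMutualInfo p V (fun ω => (Y ω).1) U₃ ∧
      R.2.2.1 ≤ condMutualInfo p X (fun ω => (Y ω).1) U -
        condMutualInfo p X (fun ω => (Y ω).2.1) U ∧
      R.2.2.1 ≤ max (mutualInfo p U₃ (fun ω => (Y ω).2.2) - R.1 -
          condMutualInfo p U₃ (fun ω => (Y ω).2.1) U) 0 +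
        condMutualInfo p X (fun ω => (Y ω).1) U₃ - condMutualInfo p X (fun ω => (Y ω).2.1) U₃ ∧
      R.2.2.2 ≤ max (condMutualInfo p V (fun ω => (Y ω).1) U₃ -
        condMutualInfo p V (fun ω => (Y ω).2.2) U₃) 0 := by
    rw [i1, i2, i3, i4, i5, i6, i7, i8, i9, i10]
    refine ⟨le_min h1 h2, h3, h4.trans_eq (add_sub_assoc _ _ _), ?_, ?_, le_max_of_le_left ?_⟩
    · refine h5.trans_eq ?_
      change f.2.1 - f.2.2.1 - (E₁ - E₂) = f.2.1 - E₁ - (f.2.2.1 - E₂)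
      ring
    · rw [add_sub_assoc]
      -- The bound holds with the positive part removed. In that form H(Z₂|U₃) cancels, leaving the
      -- profile inequality for R₀ + Rₑ₂.
      refine le_trans ?_ (add_le_add (le_max_left _ _) le_rfl)
      change R.2.2.1 ≤ outputEntropy ch.W₃ f.1.1.1 - f.1.2.2.2 - R.1 - (f.2.2.1 - f.1.2.2.1) +
        (f.1.2.1 - E₁ - (f.1.2.2.1 - E₂))
      linarith
    · refine h7.trans_eq ?_
      change f.1.2.1 - f.1.1.2.1 - f.1.2.2.2 + f.1.1.2.2.2 =
        f.1.2.1 - f.1.1.2.1 - (f.1.2.2.2 - f.1.1.2.2.2)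
      ring
  exact hgoal

end BroadcastChannel

end AuxPMF

/-! ### Entropy inequalities for n uses of a degraded memoryless channel -/

section MultiLetter

variable {𝒳 𝒴₁ 𝒵₂ 𝒵₃ Ω μ₀ μ₁ : Type*} [Fintype 𝒳] [Fintype 𝒴₁] [Fintype 𝒵₂] [Fintype 𝒵₃]
  [Fintype Ω] [Fintype μ₀] [Fintype μ₁] {n : ℕ}

/-- The sequence `Y` is the output of `n` memoryless uses of a channel `W` with input `X`, and of
each output letter `y₁` of the first receiver the letter `z₂` is a degraded version. -/
structure IsDegradedTransmission (p : Ω → ℝ) (W : 𝒳 → 𝒴₁ × 𝒵₂ × 𝒵₃ → ℝ) (r : 𝒴₁ → 𝒵₂ → ℝ)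
    (M₀ : Ω → μ₀) (M₁ : Ω → μ₁) (X : Ω → Fin n → 𝒳) (Y₁ : Ω → Fin n → 𝒴₁) (Z₂ : Ω → Fin n → 𝒵₂)
    (Z₃ : Ω → Fin n → 𝒵₃) : Prop where
  nonneg : ∀ ω, 0 ≤ p ω
  sum_eq_one : ∑ ω, p ω = 1
  memoryless : ∀ i, ChannelLaw p
    (fun ω => ((M₀ ω, M₁ ω), X ω, fun j : {j // j ≠ i} => (Y₁ ω j, Z₂ ω j, Z₃ ω j)))
    (fun ω => X ω i) (fun ω => (Y₁ ω i, Z₂ ω i, Z₃ ω i)) W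
  degraded : ∀ i, ChannelLaw p
    (fun ω => ((M₀ ω, M₁ ω), X ω, Y₁ ω, Z₃ ω, fun j : {j // j ≠ i} => Z₂ ω j))
    (fun ω => Y₁ ω i) (fun ω => Z₂ ω i) r

namespace IsDegradedTransmission

variable {p : Ω → ℝ} {W : 𝒳 → 𝒴₁ × 𝒵₂ × 𝒵₃ → ℝ} {r : 𝒴₁ → 𝒵₂ → ℝ}
    {M₀ : Ω → μ₀} {M₁ : Ω → μ₁} {X : Ω → Fin n → 𝒳} {Y₁ : Ω → Fin n → 𝒴₁} {Z₂ : Ω → Fin n → 𝒵₂}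
    {Z₃ : Ω → Fin n → 𝒵₃}

lemma channelLaw {τ : Type*} (h : IsDegradedTransmission p W r M₀ M₁ X Y₁ Z₂ Z₃) (i : Fin n)
    {S : Ω → τ} (hS : ∀ ω ω', M₀ ω = M₀ ω' → M₁ ω = M₁ ω' → X ω = X ω' →
      (∀ j ≠ i, Y₁ ω j = Y₁ ω' j ∧ Z₂ ω j = Z₂ ω' j ∧ Z₃ ω j = Z₃ ω' j) → S ω = S ω') :
    ChannelLaw p S (fun ω => X ω i) (fun ω => (Y₁ ω i, Z₂ ω i, Z₃ ω i)) W := by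
  refine (h.memoryless i).of_factorsThrough fun ω ω' hω => ?_
  simp only [Prod.mk.injEq, funext_iff (f := fun j : {j // j ≠ i} => _), Subtype.forall] at hω
  exact hS ω ω' hω.1.1 hω.1.2 hω.2.1 hω.2.2

lemma degradedLaw {τ : Type*} (h : IsDegradedTransmission p W r M₀ M₁ X Y₁ Z₂ Z₃) (i : Fin n)
    {S : Ω → τ} (hS : ∀ ω ω', M₀ ω = M₀ ω' → M₁ ω = M₁ ω' → X ω = X ω' → Y₁ ω = Y₁ ω' →
      Z₃ ω = Z₃ ω' → (∀ j ≠ i, Z₂ ω j = Z₂ ω' j) → S ω = S ω') :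
    ChannelLaw p S (fun ω => Y₁ ω i) (fun ω => Z₂ ω i) r := by
  refine (h.degraded i).of_factorsThrough fun ω ω' hω => ?_
  simp only [Prod.mk.injEq, funext_iff (f := fun j : {j // j ≠ i} => _), Subtype.forall] at hω
  exact hS ω ω' hω.1.1 hω.1.2 hω.2.1 hω.2.2.1 hω.2.2.2.1 hω.2.2.2.2

/-- The degraded letters `Z₂^{<k}` depend on everything else only through `Y₁^{<k}`. -/
lemma condEntropy_prefixMask {τ : Type*} [Fintype τ]
    (h : IsDegradedTransmission p W r M₀ M₁ X Y₁ Z₂ Z₃) {k : ℕ} (hk : k ≤ n) {T : Ω → τ}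
    (hT : ∀ ω ω', M₀ ω = M₀ ω' → M₁ ω = M₁ ω' → X ω = X ω' → Y₁ ω = Y₁ ω' →
      Z₃ ω = Z₃ ω' → (∀ j : Fin n, k ≤ j → Z₂ ω j = Z₂ ω' j) → T ω = T ω') :
    condEntropy p (prefixMask k Z₂) (fun ω => (prefixMask k Y₁ ω, T ω)) =
      ∑ j ∈ Finset.univ.filter (fun j : Fin n => (j : ℕ) < k),
        ∑ y, law p (fun ω => Y₁ ω j) y * rowEntropy r y := by
  rw [← sum_condEntropy_prefixMask h.nonneg _ _ hk]
  refine Finset.sum_congr rfl fun j hj => ?_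
  have hjk : (j : ℕ) < k := by simpa using hj
  refine (h.degradedLaw j fun ω ω' h0 h1 h2 h3 h4 h5 => ?_).condEntropy_eq_sum_rowEntropy h.nonneg
    fun ω ω' hω => ?_
  · refine Prod.ext (prefixMask_eq_iff.2 fun i hi => h5 i fun hij => by omega)
      (Prod.ext (prefixMask_eq_iff.2 fun i _ => congrFun h3 i)
        (hT ω ω' h0 h1 h2 h3 h4 fun i hi => h5 i fun hij => by omega))
  · simp only [Prod.mk.injEq, prefixMask_eq_iff] at hω
    exact hω.2.1 j hjk

/-- Given Y₁^{<i} and M₀, the past Z₂^{<i} is independent of the present Z₂ letter: its conditional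
entropy is the same with and without that letter. Adding Z₂^{<i} to the left condition therefore
changes nothing, and then dropping Y₁^{<i} can only increase the entropy. -/
lemma condEntropy_degraded_le (h : IsDegradedTransmission p W r M₀ M₁ X Y₁ Z₂ Z₃) (i : Fin n) :
    condEntropy p (fun ω => Z₂ ω i) (fun ω => (prefixMask i Y₁ ω, M₀ ω)) ≤
      condEntropy p (fun ω => Z₂ ω i) (fun ω => (prefixMask i Z₂ ω, M₀ ω)) := by
  have h1 := h.condEntropy_prefixMask i.is_lt.le (T := M₀) fun ω ω' h0 _ _ _ _ _ => h0
  have h2 := h.condEntropy_prefixMask i.is_lt.le (T := fun ω => (Z₂ ω i, M₀ ω))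
    fun ω ω' h0 _ _ _ _ h5 => Prod.ext (h5 i le_rfl) h0
  have h3 := condEntropy_le_of_factorsThrough h.nonneg (fun ω => Z₂ ω i)
    (Y := fun ω => (prefixMask i Z₂ ω, prefixMask i Y₁ ω, M₀ ω))
    (Z := fun ω => (prefixMask i Z₂ ω, M₀ ω)) fun ω ω' hω => by
      simp only [Prod.mk.injEq] at hω ⊢
      tauto
  refine le_trans (le_of_eq ?_) h3
  rw [← h2, condEntropy_eq h.nonneg, condEntropy_eq h.nonneg] at h1
  rw [condEntropy_eq h.nonneg, condEntropy_eq h.nonneg]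
  have e1 : entropy p (fun ω => (prefixMask i Z₂ ω, prefixMask i Y₁ ω, Z₂ ω i, M₀ ω)) =
      entropy p (fun ω => (Z₂ ω i, prefixMask i Z₂ ω, prefixMask i Y₁ ω, M₀ ω)) :=
    entropy_congr p fun ω ω' => by simp only [Prod.mk.injEq]; tauto
  have e2 : entropy p (fun ω => (prefixMask i Y₁ ω, Z₂ ω i, M₀ ω)) =
      entropy p (fun ω => (Z₂ ω i, prefixMask i Y₁ ω, M₀ ω)) :=
    entropy_congr p fun ω ω' => by simp only [Prod.mk.injEq]; tauto
  linarith

/-- This is H(Z₂ⁿ|Y₁ⁿ,T); the point is that its value does not depend on T. -/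
lemma condEntropy_given_first {τ : Type*} [Fintype τ]
    (h : IsDegradedTransmission p W r M₀ M₁ X Y₁ Z₂ Z₃) {T : Ω → τ}
    (hT : ∀ ω ω', M₀ ω = M₀ ω' → M₁ ω = M₁ ω' → X ω = X ω' → T ω = T ω') :
    entropy p (fun ω => (Z₂ ω, Y₁ ω, T ω)) - entropy p (fun ω => (Y₁ ω, T ω)) =
      ∑ j, ∑ y, law p (fun ω => Y₁ ω j) y * rowEntropy r y := by
  have h1 := h.condEntropy_prefixMask le_rfl (T := T) fun ω ω' h0 h1 h2 _ _ _ => hT ω ω' h0 h1 h2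
  rw [Finset.filter_true_of_mem fun j _ => j.is_lt, condEntropy_eq h.nonneg] at h1
  rw [← h1]
  congr 1
  · exact entropy_congr p fun ω ω' => by
      simp [prefixMask_eq_iff, funext_iff (f := Z₂ ω), funext_iff (f := Y₁ ω)]
  · exact entropy_congr p fun ω ω' => by
      simp [prefixMask_eq_iff, funext_iff (f := Y₁ ω)]

/-- The first receiver is less noisy than the second one. -/
lemma condEntropy_sub_le (h : IsDegradedTransmission p W r M₀ M₁ X Y₁ Z₂ Z₃) :
    condEntropy p Y₁ (fun ω => (X ω, M₁ ω, M₀ ω)) - condEntropy p Z₂ (fun ω => (X ω, M₁ ω, M₀ ω)) ≤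
      condEntropy p Y₁ (fun ω => (M₁ ω, M₀ ω)) - condEntropy p Z₂ (fun ω => (M₁ ω, M₀ ω)) := by
  -- For either condition T, H(Y₁ⁿ|T) − H(Z₂ⁿ|T) = H(Y₁ⁿ|Z₂ⁿ,T) − H(Z₂ⁿ|Y₁ⁿ,T). The last terms
  -- agree, so the claim is that conditioning on Xⁿ reduces H(Y₁ⁿ|Z₂ⁿ,M₁,M₀).
  have h1 := h.condEntropy_given_first (T := fun ω => (X ω, M₁ ω, M₀ ω))
    fun ω ω' h0 h1 h2 => by simp [h0, h1, h2]
  have h2 := h.condEntropy_given_first (T := fun ω => (M₁ ω, M₀ ω))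
    fun ω ω' h0 h1 h2 => by simp [h0, h1]
  have h3 := condEntropy_le_of_factorsThrough h.nonneg Y₁
    (Y := fun ω => (Z₂ ω, X ω, M₁ ω, M₀ ω)) (Z := fun ω => (Z₂ ω, M₁ ω, M₀ ω)) fun ω ω' hω => by
      simp only [Prod.mk.injEq] at hω ⊢
      tauto
  rw [condEntropy_eq h.nonneg, condEntropy_eq h.nonneg] at h3
  rw [condEntropy_eq h.nonneg, condEntropy_eq h.nonneg, condEntropy_eq h.nonneg,
    condEntropy_eq h.nonneg]
  have e1 : entropy p (fun ω => (Z₂ ω, Y₁ ω, X ω, M₁ ω, M₀ ω)) =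
      entropy p (fun ω => (Y₁ ω, Z₂ ω, X ω, M₁ ω, M₀ ω)) :=
    entropy_congr p fun ω ω' => by simp only [Prod.mk.injEq]; tauto
  have e2 : entropy p (fun ω => (Z₂ ω, Y₁ ω, M₁ ω, M₀ ω)) =
      entropy p (fun ω => (Y₁ ω, Z₂ ω, M₁ ω, M₀ ω)) :=
    entropy_congr p fun ω ω' => by simp only [Prod.mk.injEq]; tauto
  linarith

end IsDegradedTransmission

/-- Concavity of entropy: the output entropy of the averaged input law dominates the average, as if
a time-sharing index had been removed from the condition. -/
lemma sum_outputEntropy_le {α β ι : Type*} [Fintype α] [Fintype β] (t : Finset ι)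
    {W : α → β → ℝ} (hW : IsCondPMF W) {w : ι → ℝ} (hw : ∀ i ∈ t, 0 ≤ w i)
    (hw1 : ∑ i ∈ t, w i = 1) {π : ι → α → ℝ} (hπ : ∀ i ∈ t, π i ∈ stdSimplex ℝ α) :
    ∑ i ∈ t, w i * outputEntropy W (π i) ≤ outputEntropy W (∑ i ∈ t, w i • π i) := by
  have hl2 : 0 < Real.log 2 := Real.log_pos (by norm_num)
  rw [outputEntropy_eq_of_mem_stdSimplex W ((convex_stdSimplex ℝ α).sum_mem hw hw1 hπ),
    Finset.sum_congr rfl fun i hi => by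
      rw [outputEntropy_eq_of_mem_stdSimplex W (hπ i hi), Finset.mul_sum], Finset.sum_comm]
  refine Finset.sum_le_sum fun y _ => ?_
  have := Real.concaveOn_negMulLog.le_map_sum hw hw1
    (p := fun i => ∑ x, π i x * W x y)
    fun i hi => Set.mem_Ici.2 (Finset.sum_nonneg fun x _ => mul_nonneg ((hπ i hi).1 x) ((hW x).1 y))
  have e : ∑ i ∈ t, w i • ∑ x, π i x * W x y = ∑ x, (∑ i ∈ t, w i • π i) x * W x y := by
    simp only [Finset.sum_apply, Pi.smul_apply, smul_eq_mul, Finset.sum_mul, Finset.mul_sum]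
    rw [Finset.sum_comm]
    simp only [mul_assoc]
  rw [e] at this
  simp_rw [← mul_div_assoc, ← Finset.sum_div]
  exact div_le_div_of_nonneg_right (by simpa using this) hl2.le

end MultiLetter

/-! ### Single-letterization -/

section SingleLetter

open BroadcastChannel

variable {𝒳 𝒴₁ 𝒵₂ 𝒵₃ Ω μ₀ μ₁ : Type*} [Fintype 𝒳] [Fintype 𝒴₁] [Fintype 𝒵₂] [Fintype 𝒵₃]
  [Fintype Ω] [Fintype μ₀] [Fintype μ₁] {n : ℕ}

lemma isCondPMF_law {α β γ : Type*} [Fintype β] [Fintype γ] {W : α → β → ℝ} (hW : IsCondPMF W)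
    (g : β → γ) : IsCondPMF fun x => law (W x) g := fun x =>
  ⟨fun _ => law_nonneg (hW x).1 _ _, (sum_law _ _).trans (hW x).2⟩

/-- A degraded transmission that conveys `M₀` to all receivers and `(M₀, M₁)` to the first one
satisfies the single-letter inequalities, up to the ambiguity `δ` left to the receivers. -/
lemma IsDegradedTransmission.exists_profile {p : Ω → ℝ} {ch : BroadcastChannel 𝒳 𝒴₁ 𝒵₂ 𝒵₃}
    {r : 𝒴₁ → 𝒵₂ → ℝ} {M₀ : Ω → μ₀} {M₁ : Ω → μ₁} {X : Ω → Fin n → 𝒳} {Y₁ : Ω → Fin n → 𝒴₁}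
    {Z₂ : Ω → Fin n → 𝒵₂} {Z₃ : Ω → Fin n → 𝒵₃}
    (h : IsDegradedTransmission p ch.W r M₀ M₁ X Y₁ Z₂ Z₃) (hn : 0 < n) {L₀ L₁ δ : ℝ}
    (hM₀ : entropy p M₀ = L₀) (hM : entropy p (fun ω => (M₁ ω, M₀ ω)) = L₀ + L₁)
    (hZ₂ : condEntropy p M₀ Z₂ ≤ δ) (hZ₃ : condEntropy p M₀ Z₃ ≤ δ)
    (hY₁ : condEntropy p (fun ω => (M₁ ω, M₀ ω)) Y₁ ≤ δ) :
    ∃ f ∈ ch.profiles₃, ch.ProfileInequalities f ((L₀ - δ) / n, (L₁ - δ) / n,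
      (condEntropy p M₁ Z₂ - 2 * δ) / n, (condEntropy p M₁ Z₃ - 2 * δ) / n) := by
  have hp := h.nonneg
  have hp1 := h.sum_eq_one
  have hn' : (0 : ℝ) < n := by exact_mod_cast hn
  let Y : Fin n → Ω → 𝒴₁ × 𝒵₂ × 𝒵₃ := fun i ω => (Y₁ ω i, Z₂ ω i, Z₃ ω i)
  -- The auxiliary variables at position i are U_i, (U_i, T_i) in the role of U₃, and ((U_i, T_i),
  -- M₁) in the role of V. They involve no output at position i, so the letter `X ω i` screens them
  -- off from the outputs there.
  let U : Fin n → Ω → (Fin n → Option 𝒴₁) × μ₀ := fun i ω => (prefixMask i Y₁ ω, M₀ ω)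
  let T : Fin n → Ω → (Fin n → Option 𝒵₃) := fun i => suffixMask (i + 1) Z₃
  let A : Fin n → ℝ × ℝ × ℝ := fun i => condOutputEntropies p (Y i) fun ω => ((U i ω, T i ω), M₁ ω)
  let B : Fin n → ℝ × ℝ × ℝ := fun i => condOutputEntropies p (Y i) fun ω => (U i ω, T i ω)
  let C : Fin n → ℝ × ℝ × ℝ := fun i => condOutputEntropies p (Y i) (U i)
  let π : Fin n → 𝒳 → ℝ := fun i => law p fun ω => X ω i
  let F : Fin n → (((𝒳 → ℝ) × ℝ × ℝ × ℝ) × ℝ × ℝ × ℝ) × ℝ × ℝ × ℝ :=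
    fun i => (((π i, A i), B i), C i)
  have hUT : ∀ i, ChannelLaw p (fun ω => ((U i ω, T i ω), M₁ ω)) (fun ω => X ω i) (Y i) ch.W := by
    intro i
    refine h.channelLaw i fun ω ω' h0 h1 h2 h3 => ?_
    simp only [U, T, Prod.mk.injEq, prefixMask_eq_iff, suffixMask_eq_iff]
    exact ⟨⟨⟨fun j hj => (h3 j fun hij => by omega).1, h0⟩,
      fun j hj => (h3 j fun hij => by omega).2.2⟩, h1⟩
  have hF : ∀ i, F i ∈ ch.profiles₃ := fun i => profile_mem hp hp1 ch (hUT i)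
  set w : ℝ := (n : ℝ)⁻¹ with hw
  have hw0 : 0 ≤ w := by positivity
  have hw1 : ∑ _i : Fin n, w = 1 := by simp [hw, hn'.ne']
  -- Uniform time sharing, carried out as an average inside the convex set of profiles.
  refine ⟨∑ i, w • F i, convex_graphHull.sum_mem (fun _ _ => hw0) hw1 fun i _ => hF i, ?_⟩
  have s1 : condEntropy p Y₁ M₀ = ∑ i, (C i).1 := (sum_condEntropy_chain hp Y₁ M₀).symm
  have s2 : condEntropy p Y₁ M₀ - condEntropy p Z₃ M₀ = ∑ i, (B i).1 - ∑ i, (B i).2.2 := by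
    rw [← sum_condEntropy_sub hp, ← Finset.sum_sub_distrib]
    refine Finset.sum_congr rfl fun i _ => ?_
    congr 1 <;> refine condEntropy_congr hp (fun ω ω' => ?_) (fun ω ω' => ?_) <;>
      simp only [Prod.mk.injEq, U, T, Y] <;> tauto
  have s3 : condEntropy p Y₁ (fun ω => (M₁ ω, M₀ ω)) - condEntropy p Z₃ (fun ω => (M₁ ω, M₀ ω)) =
      ∑ i, (A i).1 - ∑ i, (A i).2.2 := by
    rw [← sum_condEntropy_sub hp, ← Finset.sum_sub_distrib]
    refine Finset.sum_congr rfl fun i _ => ?_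
    congr 1 <;> refine condEntropy_congr hp (fun ω ω' => ?_) (fun ω ω' => ?_) <;>
      simp only [Prod.mk.injEq, U, T, Y] <;> tauto
  have s4 : ∑ i, (A i).1 ≤ condEntropy p Y₁ (fun ω => (M₁ ω, M₀ ω)) := by
    rw [← sum_condEntropy_chain hp]
    refine Finset.sum_le_sum fun i _ => condEntropy_le_of_factorsThrough hp _ fun ω ω' hω => ?_
    simp only [Prod.mk.injEq, U, T] at hω ⊢
    tauto
  have s5 : ∑ i, (B i).1 ≤ ∑ i, (C i).1 :=
    Finset.sum_le_sum fun i _ => condEntropy_le_of_factorsThrough hp _ fun ω ω' hω =>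
      (congrArg Prod.fst hω :)
  have s6 : ∑ i, (C i).2.1 ≤ condEntropy p Z₂ M₀ := by
    rw [← sum_condEntropy_chain hp]
    exact Finset.sum_le_sum fun i _ => h.condEntropy_degraded_le i
  have s7 : entropy p Z₂ ≤ ∑ i, outputEntropy ch.W₂ (π i) := by
    refine (entropy_le_sum hp hp1 _).trans_eq (Finset.sum_congr rfl fun i _ => ?_)
    exact ((hUT i).map_output fun y => y.2.1).entropy_eq_outputEntropy hp hp1
  have s8 : entropy p Z₃ ≤ ∑ i, outputEntropy ch.W₃ (π i) := by
    refine (entropy_le_sum hp hp1 _).trans_eq (Finset.sum_congr rfl fun i _ => ?_)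
    exact ((hUT i).map_output fun y => y.2.2).entropy_eq_outputEntropy hp hp1
  have s9 : ∑ i, ∑ x, π i x * (rowEntropy ch.W₁ x - rowEntropy ch.W₂ x) ≤
      condEntropy p Y₁ (fun ω => (M₁ ω, M₀ ω)) - condEntropy p Z₂ (fun ω => (M₁ ω, M₀ ω)) := by
    refine le_trans (le_of_eq ?_) h.condEntropy_sub_le
    simp only [mul_sub, Finset.sum_sub_distrib]
    rw [← sum_condEntropy_chain hp Y₁, ← sum_condEntropy_chain hp Z₂]
    congr 1
    · refine Finset.sum_congr rfl fun i _ => (((h.channelLaw i ?_).map_output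
        fun y => y.1).condEntropy_eq_sum_rowEntropy hp ?_).symm
      · intro ω ω' h0 h1 h2 h3
        simp only [Prod.mk.injEq, prefixMask_eq_iff]
        exact ⟨fun j hj => (h3 j fun hij => by omega).1, h2, h1, h0⟩
      · exact fun ω ω' hω => congrArg (fun t => t.2.1 i) hω
    · refine Finset.sum_congr rfl fun i _ => (((h.channelLaw i ?_).map_output
        fun y => y.2.1).condEntropy_eq_sum_rowEntropy hp ?_).symm
      · intro ω ω' h0 h1 h2 h3
        simp only [Prod.mk.injEq, prefixMask_eq_iff]
        exact ⟨fun j hj => (h3 j fun hij => by omega).2.1, h2, h1, h0⟩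
      · exact fun ω ω' hω => congrArg (fun t => t.2.1 i) hω
  have hπ : ∀ i ∈ Finset.univ, π i ∈ stdSimplex ℝ 𝒳 := fun i _ =>
    ⟨fun _ => law_nonneg hp _ _, (sum_law _ _).trans hp1⟩
  have j2 := sum_outputEntropy_le Finset.univ (isCondPMF_law ch.isCondPMF fun y => y.2.1)
    (fun _ _ => hw0) hw1 hπ
  have j3 := sum_outputEntropy_le Finset.univ (isCondPMF_law ch.isCondPMF fun y => y.2.2)
    (fun _ _ => hw0) hw1 hπ
  rw [← Finset.mul_sum] at j2 j3
  change w * ∑ i, outputEntropy ch.W₂ (π i) ≤ outputEntropy ch.W₂ _ at j2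
  change w * ∑ i, outputEntropy ch.W₃ (π i) ≤ outputEntropy ch.W₃ _ at j3
  have t1 : L₀ - δ ≤ ∑ i, outputEntropy ch.W₂ (π i) - ∑ i, (C i).2.1 := by
    have e : entropy p (fun ω => (M₀ ω, Z₂ ω)) = entropy p (fun ω => (Z₂ ω, M₀ ω)) :=
      entropy_congr p fun ω ω' => by simp [and_comm]
    rw [condEntropy_eq hp] at hZ₂ s6
    linarith
  -- From I(M₀;Z₃ⁿ), with H(Z₃ⁿ|M₀) rewritten by Csiszár's identity. The subtracted difference is
  -- the slack I(U₃;Y₁|U): nonnegative by `s5`, and kept for adding `t3` and `t4`.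
  have t2 : L₀ - δ ≤ ∑ i, outputEntropy ch.W₃ (π i) - (∑ i, (C i).1 - ∑ i, (B i).1) -
      ∑ i, (B i).2.2 := by
    have e : entropy p (fun ω => (M₀ ω, Z₃ ω)) = entropy p (fun ω => (Z₃ ω, M₀ ω)) :=
      entropy_congr p fun ω ω' => by simp [and_comm]
    have : condEntropy p Z₃ M₀ = entropy p (fun ω => (Z₃ ω, M₀ ω)) - entropy p M₀ :=
      condEntropy_eq hp _ _
    rw [condEntropy_eq hp] at hZ₃
    linarith
  -- H(M₁|Y₁ⁿ,M₀) is at most H(M₁,M₀|Y₁ⁿ).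
  have hYM : entropy p (fun ω => (Y₁ ω, M₁ ω, M₀ ω)) - entropy p (fun ω => (Y₁ ω, M₀ ω)) ≤ δ := by
    have e : entropy p (fun ω => ((M₁ ω, M₀ ω), Y₁ ω)) = entropy p (fun ω => (Y₁ ω, M₁ ω, M₀ ω)) :=
      entropy_congr p fun ω ω' => by simp only [Prod.mk.injEq]; tauto
    have := entropy_le_of_factorsThrough hp (X := Y₁) (Y := fun ω => (Y₁ ω, M₀ ω))
      fun ω ω' hω => (congrArg Prod.fst hω :)
    rw [condEntropy_eq hp] at hY₁
    linarith
  have c1 := condEntropy_eq hp Y₁ M₀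
  have c2 := condEntropy_eq hp Y₁ fun ω => (M₁ ω, M₀ ω)
  have t3 : L₁ - δ ≤ ∑ i, (C i).1 - ∑ i, (A i).1 := by linarith
  -- Up to 2δ, the equivocation is at most I(M₁;Y₁ⁿ|M₀) − I(M₁;Z₂ⁿ|M₀): one δ pays for inserting M₀
  -- into the condition, the other for H(M₁|Y₁ⁿ,M₀). Then `s9` and `s6` replace the n-letter terms.
  have t4 : condEntropy p M₁ Z₂ - 2 * δ ≤ ∑ i, (C i).1 - ∑ i, (C i).2.1 -
      ∑ i, ∑ x, π i x * (rowEntropy ch.W₁ x - rowEntropy ch.W₂ x) := by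
    have e : entropy p (fun ω => (M₀ ω, Z₂ ω)) = entropy p (fun ω => (Z₂ ω, M₀ ω)) :=
      entropy_congr p fun ω ω' => by simp [and_comm]
    have := entropy_le_of_factorsThrough hp (X := fun ω => (M₁ ω, Z₂ ω))
      (Y := fun ω => (Z₂ ω, M₁ ω, M₀ ω)) fun ω ω' hω => by
        simp only [Prod.mk.injEq] at hω ⊢
        tauto
    have c3 := condEntropy_eq hp Z₂ M₀
    have c4 := condEntropy_eq hp Z₂ fun ω => (M₁ ω, M₀ ω)
    rw [condEntropy_eq hp] at hZ₂ ⊢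
    linarith
  have t5 : condEntropy p M₁ Z₃ - 2 * δ ≤ ∑ i, (B i).1 - ∑ i, (A i).1 - ∑ i, (B i).2.2 +
      ∑ i, (A i).2.2 := by
    have e : entropy p (fun ω => (M₀ ω, Z₃ ω)) = entropy p (fun ω => (Z₃ ω, M₀ ω)) :=
      entropy_congr p fun ω ω' => by simp [and_comm]
    have := entropy_le_of_factorsThrough hp (X := fun ω => (M₁ ω, Z₃ ω))
      (Y := fun ω => (Z₃ ω, M₁ ω, M₀ ω)) fun ω ω' hω => by
        simp only [Prod.mk.injEq] at hω ⊢
        tauto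
    have c3 := condEntropy_eq hp Z₃ M₀
    have c4 := condEntropy_eq hp Z₃ fun ω => (M₁ ω, M₀ ω)
    rw [condEntropy_eq hp] at hZ₃ ⊢
    linarith
  have v1 : (∑ i, w • F i).1.1.1 = ∑ i, w • π i := by simp [F, Prod.fst_sum]
  have v2 : (∑ i, w • F i).1.1.2 = w • ∑ i, A i := by
    simp [F, Prod.fst_sum, Prod.snd_sum, Finset.smul_sum]
  have v3 : (∑ i, w • F i).1.2 = w • ∑ i, B i := by
    simp [F, Prod.fst_sum, Prod.snd_sum, Finset.smul_sum]
  have v4 : (∑ i, w • F i).2 = w • ∑ i, C i := by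
    simp [F, Prod.snd_sum, Finset.smul_sum]
  have v5 : ∑ x, (∑ i, w • π i) x * (rowEntropy ch.W₁ x - rowEntropy ch.W₂ x) =
      w * ∑ i, ∑ x, π i x * (rowEntropy ch.W₁ x - rowEntropy ch.W₂ x) := by
    simp only [Finset.sum_apply, Pi.smul_apply, smul_eq_mul, Finset.sum_mul, Finset.mul_sum]
    rw [Finset.sum_comm]
    simp only [mul_assoc]
  unfold ProfileInequalities
  rw [v1, v2, v3, v4, v5]
  simp only [Prod.smul_fst, Prod.smul_snd, Prod.fst_sum, Prod.snd_sum, smul_eq_mul, div_eq_inv_mul,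
    ← hw]
  have m : ∀ {a b : ℝ}, a ≤ b → w * a ≤ w * b := fun hab => mul_le_mul_of_nonneg_left hab hw0
  have m1 := m t1
  have m2 := m t2
  have m3 := m t3
  have m4 := m t4
  have m5 := m t5
  have m6 := m s5
  simp only [mul_sub, mul_add] at m1 m2 m3 m4 m5 m6 ⊢
  -- The bound on R₀ + R₁ is `t2` plus `t3`, that on R₀ + Rₑ₂ is `t2` plus `t4`; in both, the slack
  -- turns an entropy given U into one given U₃.
  refine ⟨?_, ?_, ?_, ?_, ?_, ?_, ?_⟩ <;> linarith

end SingleLetter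

/-! ### From codes to the single-letter region -/

section Codes

open BroadcastChannel

/-- Since (S, Y) are coordinates on the sample space, p is their joint pmf; summing over y gives
g(s) as the law of S at attained values, and X is a function of S. -/
lemma ChannelLaw.of_factorization {Ω σ α β : Type*} [Fintype Ω] [Fintype β] {p : Ω → ℝ}
    {S : Ω → σ} {X : Ω → α} {Y : Ω → β} {W : α → β → ℝ} (hW : IsCondPMF W)
    (hX : X.FactorsThrough S) (hbij : Function.Bijective fun ω => (S ω, Y ω)) (g : σ → ℝ)
    (hg : ∀ ω, p ω = g (S ω) * W (X ω) (Y ω)) : ChannelLaw p S X Y W := by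
  classical
  have hSY : ∀ ω y, law p (fun ω => (S ω, Y ω)) (S ω, y) = g (S ω) * W (X ω) y := by
    intro ω y
    obtain ⟨ω', hω'⟩ := hbij.2 (S ω, y)
    simp only [Prod.mk.injEq] at hω'
    unfold law
    rw [Finset.sum_eq_single ω']
    · rw [if_pos (Prod.ext hω'.1 hω'.2), hg, hω'.1, hω'.2, hX hω'.1]
    · intro b _ hb
      exact if_neg fun h => hb (hbij.1 (h.trans (Prod.ext hω'.1.symm hω'.2.symm)))
    · simp
  intro s x y
  by_cases hs : ∃ ω, S ω = s ∧ X ω = x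
  · obtain ⟨ω, rfl, rfl⟩ := hs
    have h1 : ∀ ω', (S ω', X ω') = (S ω, X ω) ↔ S ω' = S ω := fun ω' => by
      simpa using fun h => hX h
    rw [law_congr p h1, ← sum_law_pair_right p S Y]
    simp_rw [hSY]
    rw [← Finset.mul_sum, (hW _).2, mul_one, ← hSY]
    refine law_congr p fun ω' => ?_
    simp only [Prod.mk.injEq]
    exact ⟨fun h => ⟨h.1, h.2.2⟩, fun h => ⟨h.1, hX h.1, h.2⟩⟩
  · have h1 : ∀ ω, (S ω, X ω, Y ω) ≠ (s, x, y) := fun ω h => hs ⟨ω, by simp_all⟩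
    have h2 : ∀ ω, (S ω, X ω) ≠ (s, x) := fun ω h => hs ⟨ω, by simp_all⟩
    simp [law, h1, h2]

variable {𝒳 𝒴₁ 𝒵₂ 𝒵₃ : Type*} [Fintype 𝒳] [Fintype 𝒴₁] [Fintype 𝒵₂] [Fintype 𝒵₃] {n k₀ k₁ : ℕ}

lemma sum_prod_channel {𝒳 : Type*} (ch : BroadcastChannel 𝒳 𝒴₁ 𝒵₂ 𝒵₃) (x : Fin n → 𝒳) :
    ∑ y : (Fin n → 𝒴₁) × (Fin n → 𝒵₂) × (Fin n → 𝒵₃), ∏ i, ch.W (x i) (y.1 i, y.2.1 i, y.2.2 i)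
      = 1 := by
  let e : (Fin n → 𝒴₁ × 𝒵₂ × 𝒵₃) ≃ (Fin n → 𝒴₁) × (Fin n → 𝒵₂) × (Fin n → 𝒵₃) :=
    { toFun := fun y => (fun i => (y i).1, fun i => (y i).2.1, fun i => (y i).2.2)
      invFun := fun y i => (y.1 i, y.2.1 i, y.2.2 i)
      left_inv := fun _ => rfl
      right_inv := fun _ => rfl }
  classical
  rw [← e.sum_comp]
  have := Finset.prod_univ_sum (fun _ : Fin n => (Finset.univ : Finset (𝒴₁ × 𝒵₂ × 𝒵₃)))
    fun i y => ch.W (x i) y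
  simp only [(ch.isCondPMF _).2, Finset.prod_const_one, Fintype.piFinset_univ] at this
  exact this.symm

namespace SecrecyCode

variable (c : SecrecyCode 𝒳 𝒴₁ 𝒵₂ 𝒵₃ n k₀ k₁) (ch : BroadcastChannel 𝒳 𝒴₁ 𝒵₂ 𝒵₃)

lemma jointPMF_nonneg
    (ω : (Fin k₀ × Fin k₁) × (Fin n → 𝒳) × (Fin n → 𝒴₁) × (Fin n → 𝒵₂) × (Fin n → 𝒵₃)) :
    0 ≤ c.jointPMF ch ω := by
  obtain ⟨m, x, y₁, z₂, z₃⟩ := ω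
  exact mul_nonneg (mul_nonneg (by positivity) ((c.enc_isCondPMF m).1 x))
    (Finset.prod_nonneg fun i _ => (ch.isCondPMF _).1 _)

lemma law_messages (m : Fin k₀ × Fin k₁) :
    law (c.jointPMF ch) (fun ω => ω.1) m = 1 / ((k₀ : ℝ) * k₁) := by
  classical
  have h : ∀ x, ∑ y : (Fin n → 𝒴₁) × (Fin n → 𝒵₂) × (Fin n → 𝒵₃), c.jointPMF ch (m, x, y) =
      1 / ((k₀ : ℝ) * k₁) * c.enc m x := by
    intro x
    have := sum_prod_channel ch x
    simp only [jointPMF]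
    rw [← Finset.mul_sum, this, mul_one]
  unfold law
  rw [Fintype.sum_prod_type, Finset.sum_eq_single m (fun m' _ hm => by simp [hm]) (by simp)]
  simp only [if_true]
  rw [Fintype.sum_prod_type]
  simp_rw [h]
  rw [← Finset.mul_sum, (c.enc_isCondPMF m).2, mul_one]

/-- The product pmf is split at position i: for the memoryless law the factor `W` is isolated, for
the degraded law only `r`, while all factors `q` go into the weight of the condition. -/
lemma isDegradedTransmission (hk₀ : 0 < k₀) (hk₁ : 0 < k₁) {q : 𝒳 → 𝒴₁ × 𝒵₃ → ℝ}
    {r : 𝒴₁ → 𝒵₂ → ℝ} (hr : IsCondPMF r)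
    (hqr : ∀ x y₁ z₂ z₃, ch.W x (y₁, z₂, z₃) = q x (y₁, z₃) * r y₁ z₂) :
    IsDegradedTransmission (c.jointPMF ch) ch.W r (fun ω => ω.1.1) (fun ω => ω.1.2) (fun ω => ω.2.1)
      (fun ω => ω.2.2.1) (fun ω => ω.2.2.2.1) (fun ω => ω.2.2.2.2) where
  nonneg := c.jointPMF_nonneg ch
  sum_eq_one := by
    rw [← sum_law _ fun ω => ω.1]
    simp_rw [c.law_messages ch]
    rw [Finset.sum_const, Finset.card_univ, Fintype.card_prod, Fintype.card_fin, Fintype.card_fin,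
      nsmul_eq_mul]
    push_cast
    have : (k₀ : ℝ) ≠ 0 := by positivity
    have : (k₁ : ℝ) ≠ 0 := by positivity
    field_simp
  memoryless i := by
    refine ChannelLaw.of_factorization ch.isCondPMF
      (fun ω ω' h => congrArg (fun t => t.2.1 i) h) ⟨?_, ?_⟩
      (fun s => 1 / ((k₀ : ℝ) * k₁) * c.enc s.1 s.2.1 *
        ∏ j : {j // j ≠ i}, ch.W (s.2.1 j) (s.2.2 j))
      ?_
    · rintro ⟨m, x, y₁, z₂, z₃⟩ ⟨m', x', y₁', z₂', z₃'⟩ h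
      simp only [Prod.mk.injEq, funext_iff (f := fun j : {j // j ≠ i} => _), Subtype.forall] at h
      obtain ⟨⟨⟨h0, h1⟩, h2, h3⟩, h4⟩ := h
      have h5 : ∀ j, y₁ j = y₁' j ∧ z₂ j = z₂' j ∧ z₃ j = z₃' j := fun j => by
        rcases eq_or_ne j i with rfl | hj
        · exact h4
        · exact h3 j hj
      simp only [Prod.mk.injEq]
      exact ⟨Prod.ext h0 h1, h2, funext fun j => (h5 j).1, funext fun j => (h5 j).2.1,
        funext fun j => (h5 j).2.2⟩
    · rintro ⟨⟨m, x, t⟩, y⟩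
      refine ⟨(m, x, fun j => if h : j = i then y.1 else (t ⟨j, h⟩).1,
        fun j => if h : j = i then y.2.1 else (t ⟨j, h⟩).2.1,
        fun j => if h : j = i then y.2.2 else (t ⟨j, h⟩).2.2), ?_⟩
      simp only [Prod.mk.injEq, dite_true, Prod.mk.eta, true_and, and_true]
      funext j
      simp [j.2]
    · rintro ⟨m, x, y₁, z₂, z₃⟩
      simp only [jointPMF]
      rw [Fintype.prod_eq_mul_prod_subtype_ne _ i]
      ring
  degraded i := by
    refine ChannelLaw.of_factorization hr
      (fun ω ω' h => congrArg (fun t => t.2.2.1 i) h) ⟨?_, ?_⟩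
      (fun s => 1 / ((k₀ : ℝ) * k₁) * c.enc s.1 s.2.1 *
        (∏ j, q (s.2.1 j) (s.2.2.1 j, s.2.2.2.1 j)) *
          ∏ j : {j // j ≠ i}, r (s.2.2.1 j) (s.2.2.2.2 j)) ?_
    · rintro ⟨m, x, y₁, z₂, z₃⟩ ⟨m', x', y₁', z₂', z₃'⟩ h
      simp only [Prod.mk.injEq, funext_iff (f := fun j : {j // j ≠ i} => _), Subtype.forall] at h
      obtain ⟨⟨⟨h0, h1⟩, h2, h3, h4, h5⟩, h6⟩ := h
      have h7 : ∀ j, z₂ j = z₂' j := fun j => by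
        rcases eq_or_ne j i with rfl | hj
        · exact h6
        · exact h5 j hj
      simp only [Prod.mk.injEq]
      exact ⟨Prod.ext h0 h1, h2, h3, funext h7, h4⟩
    · rintro ⟨⟨m, x, y₁, z₃, t⟩, z⟩
      refine ⟨(m, x, y₁, fun j => if h : j = i then z else t ⟨j, h⟩, z₃), ?_⟩
      simp only [Prod.mk.injEq, dite_true, true_and, and_true]
      funext j
      simp [j.2]
    · rintro ⟨m, x, y₁, z₂, z₃⟩
      simp only [jointPMF, hqr, Finset.prod_mul_distrib]
      rw [Fintype.prod_eq_mul_prod_subtype_ne (fun j => r (y₁ j) (z₂ j)) i]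
      ring

lemma entropy_common (hk₀ : 0 < k₀) (hk₁ : 0 < k₁) :
    entropy (c.jointPMF ch) (fun ω => ω.1.1) = Real.logb 2 k₀ := by
  have : Nonempty (Fin k₀) := ⟨⟨0, hk₀⟩⟩
  rw [entropy_eq_of_uniform, Fintype.card_fin]
  intro m₀
  rw [← sum_law_pair_right _ _ fun ω => ω.1.2]
  have h1 : ∀ m₁, law (c.jointPMF ch) (fun ω => (ω.1.1, ω.1.2)) (m₀, m₁) = 1 / ((k₀ : ℝ) * k₁) :=
    fun m₁ => c.law_messages ch (m₀, m₁)
  simp_rw [h1]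
  have : (k₀ : ℝ) ≠ 0 := by positivity
  have : (k₁ : ℝ) ≠ 0 := by positivity
  simp
  field_simp

lemma entropy_messages (hk₀ : 0 < k₀) (hk₁ : 0 < k₁) :
    entropy (c.jointPMF ch) (fun ω => (ω.1.2, ω.1.1)) = Real.logb 2 k₀ + Real.logb 2 k₁ := by
  have : Nonempty (Fin k₀ × Fin k₁) := ⟨⟨0, hk₀⟩, ⟨0, hk₁⟩⟩
  rw [entropy_congr _ (Y := fun ω => ω.1) fun ω ω' => by simp [Prod.ext_iff, and_comm],
    entropy_eq_of_uniform]
  · rw [Fintype.card_prod, Fintype.card_fin, Fintype.card_fin]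
    push_cast
    exact Real.logb_mul (by positivity) (by positivity)
  · intro m
    rw [c.law_messages ch, Fintype.card_prod, Fintype.card_fin, Fintype.card_fin]
    push_cast
    rfl

lemma errorProb_nonneg : 0 ≤ c.errorProb ch := by
  unfold errorProb prob
  refine Finset.sum_nonneg fun ω _ => ?_
  split_ifs
  · exact c.jointPMF_nonneg ch ω
  · rfl

/-- Every code for a multilevel broadcast channel satisfies the single-letter inequalities up to
Fano's bound on the ambiguity. -/
lemma exists_profile (hch : ch.IsMultilevel) (hn : 0 < n) (hk₀ : 0 < k₀) (hk₁ : 0 < k₁) {δ : ℝ}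
    (hδ : 1 + c.errorProb ch * (Real.logb 2 k₀ + Real.logb 2 k₁) ≤ δ) :
    ∃ f ∈ ch.profiles₃, ch.ProfileInequalities f ((Real.logb 2 k₀ - δ) / n,
      (Real.logb 2 k₁ - δ) / n, (c.equivocation₂ ch - 2 * δ) / n,
      (c.equivocation₃ ch - 2 * δ) / n) := by
  obtain ⟨q, r, -, hr, hqr⟩ := hch
  have h := c.isDegradedTransmission ch hk₀ hk₁ hr hqr
  have hp := h.nonneg
  have hp1 := h.sum_eq_one
  have : Nonempty (Fin k₀) := ⟨⟨0, hk₀⟩⟩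
  have : Nonempty (Fin k₁) := ⟨⟨0, hk₁⟩⟩
  have hl₀ : 0 ≤ Real.logb 2 k₀ := Real.logb_nonneg (by norm_num) (by exact_mod_cast hk₀)
  have hl₁ : 0 ≤ Real.logb 2 k₁ := Real.logb_nonneg (by norm_num) (by exact_mod_cast hk₁)
  have hPe := c.errorProb_nonneg ch
  have hle : 1 + c.errorProb ch * Real.logb 2 k₀ ≤ δ := by
    nlinarith [mul_nonneg hPe hl₁]
  refine h.exists_profile hn (c.entropy_common ch hk₀ hk₁) (c.entropy_messages ch hk₀ hk₁) ?_ ?_ ?_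
  · have := condEntropy_le_fano hp hp1 (fun ω => ω.1.1) (fun ω => ω.2.2.2.1) c.dec₂
      {ω | match ω with
        | (m, _, y₁, z₂, z₃) => c.dec₁ y₁ ≠ some m ∨ c.dec₂ z₂ ≠ some m.1 ∨ c.dec₃ z₃ ≠ some m.1}
      fun ω hω => by simp at hω; tauto
    rw [Fintype.card_fin] at this
    exact this.trans hle
  · have := condEntropy_le_fano hp hp1 (fun ω => ω.1.1) (fun ω => ω.2.2.2.2) c.dec₃
      {ω | match ω with
        | (m, _, y₁, z₂, z₃) => c.dec₁ y₁ ≠ some m ∨ c.dec₂ z₂ ≠ some m.1 ∨ c.dec₃ z₃ ≠ some m.1}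
      fun ω hω => by simp at hω; tauto
    rw [Fintype.card_fin] at this
    exact this.trans hle
  · have := condEntropy_le_fano hp hp1 (fun ω => ω.1) (fun ω => ω.2.2.1) c.dec₁
      {ω | match ω with
        | (m, _, y₁, z₂, z₃) => c.dec₁ y₁ ≠ some m ∨ c.dec₂ z₂ ≠ some m.1 ∨ c.dec₃ z₃ ≠ some m.1}
      fun ω hω => by simp at hω; tauto
    rw [Fintype.card_prod, Fintype.card_fin, Fintype.card_fin, Nat.cast_mul,
      Real.logb_mul (by positivity) (by positivity)] at this
    refine le_trans (le_of_eq ?_) (this.trans hδ)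
    exact condEntropy_congr hp (fun ω ω' => by
      simp only [Prod.ext_iff (x := ω.1), Prod.mk.injEq]
      tauto)
      fun ω ω' => Iff.rfl

end SecrecyCode

lemma BroadcastChannel.ProfileInequalities.mono {ch : BroadcastChannel 𝒳 𝒴₁ 𝒵₂ 𝒵₃}
    {f : (((𝒳 → ℝ) × ℝ × ℝ × ℝ) × ℝ × ℝ × ℝ) × ℝ × ℝ × ℝ} {R R' : ℝ × ℝ × ℝ × ℝ}
    (h : ch.ProfileInequalities f R) (h₀ : R'.1 ≤ R.1) (h₁ : R'.2.1 ≤ R.2.1)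
    (h₂ : R'.2.2.1 ≤ R.2.2.1) (h₃ : R'.2.2.2 ≤ R.2.2.2) : ch.ProfileInequalities f R' := by
  obtain ⟨a1, a2, a3, a4, a5, a6, a7⟩ := h
  exact ⟨h₀.trans a1, h₀.trans a2, h₁.trans a3, (add_le_add h₀ h₁).trans a4, h₂.trans a5,
    (add_le_add h₀ h₂).trans a6, h₃.trans a7⟩

lemma one_le_floor_two_rpow {t : ℝ} (ht : 0 ≤ t) : 1 ≤ ⌊(2 : ℝ) ^ t⌋₊ :=
  Nat.one_le_floor_iff _ |>.2 (Real.one_le_rpow (by norm_num) ht)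

lemma logb_floor_le {t : ℝ} (ht : 0 ≤ t) : Real.logb 2 ⌊(2 : ℝ) ^ t⌋₊ ≤ t := by
  rw [Real.logb_le_iff_le_rpow (by norm_num) (by exact_mod_cast one_le_floor_two_rpow ht)]
  exact Nat.floor_le (by positivity)

lemma le_logb_floor {t : ℝ} (ht : 0 ≤ t) : t - 1 ≤ Real.logb 2 ⌊(2 : ℝ) ^ t⌋₊ := by
  have h1 : (1 : ℝ) ≤ ⌊(2 : ℝ) ^ t⌋₊ := by exact_mod_cast one_le_floor_two_rpow ht
  rw [Real.le_logb_iff_rpow_le (by norm_num) (by linarith), Real.rpow_sub_one (by norm_num)]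
  have := Nat.lt_floor_add_one ((2 : ℝ) ^ t)
  linarith

/-- A single sufficiently long code puts the tuple, lowered by 2ε, into the region; closedness then
lets ε tend to 0. -/
lemma mem_profileRegion_of_isAchievable {ch : BroadcastChannel 𝒳 𝒴₁ 𝒵₂ 𝒵₃}
    (hch : ch.IsMultilevel) {R₀ R₁ Re₂ Re₃ : ℝ} (h : IsAchievable ch R₀ R₁ Re₂ Re₃) :
    (R₀, R₁, Re₂, Re₃) ∈ {R | ∃ f ∈ ch.profiles₃, ch.ProfileInequalities f R} := by
  obtain ⟨hR₀, hR₁, c, herr, h₂, h₃⟩ := h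
  have key : ∀ ε > 0, (R₀ - 2 * ε, R₁ - 2 * ε, Re₂ - 2 * ε, Re₃ - 2 * ε) ∈
      {R | ∃ f ∈ ch.profiles₃, ch.ProfileInequalities f R} := by
    intro ε hε
    -- A common bound on all losses: rounding the message sets costs a rate at most 1/n, and δ/n =
    -- 1/n + Pₑ(R₀ + R₁) is charged once to each rate and twice to each equivocation.
    have hlim : Tendsto (fun n : ℕ => 3 * (1 / (n : ℝ)) + 2 * ((c n).errorProb ch * (R₀ + R₁)))
        atTop (𝓝 0) := by
      have := (tendsto_one_div_atTop_nhds_zero_nat (𝕜 := ℝ)).const_mul 3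
      simpa using this.add ((herr.mul_const (R₀ + R₁)).const_mul 2)
    have hbdd : ∀ (u : ℕ → ℝ), (∀ n, 0 ≤ u n) → IsBoundedUnder (· ≥ ·) atTop u := fun u hu =>
      isBoundedUnder_of ⟨0, hu⟩
    have e₂ := eventually_lt_of_lt_liminf ((sub_lt_self Re₂ hε).trans_le h₂) (hbdd _ fun n =>
      div_nonneg (condEntropy_nonneg ((c n).jointPMF_nonneg ch) _ _) n.cast_nonneg)
    have e₃ := eventually_lt_of_lt_liminf ((sub_lt_self Re₃ hε).trans_le h₃) (hbdd _ fun n =>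
      div_nonneg (condEntropy_nonneg ((c n).jointPMF_nonneg ch) _ _) n.cast_nonneg)
    obtain ⟨n, h1, h2, h3, hn⟩ := ((hlim.eventually_lt_const hε).and
      (e₂.and (e₃.and (eventually_gt_atTop 0)))).exists
    have hn' : (0 : ℝ) < n := by exact_mod_cast hn
    have ht₀ : 0 ≤ (n : ℝ) * R₀ := by positivity
    have ht₁ : 0 ≤ (n : ℝ) * R₁ := by positivity
    have hPe := (c n).errorProb_nonneg ch
    obtain ⟨f, hf, hineq⟩ := (c n).exists_profile ch hch hn (one_le_floor_two_rpow ht₀)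
      (one_le_floor_two_rpow ht₁) (δ := 1 + (c n).errorProb ch * (n * R₀ + n * R₁))
      (add_le_add_right (mul_le_mul_of_nonneg_left (add_le_add (logb_floor_le ht₀)
        (logb_floor_le ht₁)) hPe) _)
    have hδ : (1 + (c n).errorProb ch * (n * R₀ + n * R₁)) / n =
        1 / n + (c n).errorProb ch * (R₀ + R₁) := by
      field_simp
    have hinv : (0 : ℝ) < 1 / n := by positivity
    have hPR : 0 ≤ (c n).errorProb ch * (R₀ + R₁) := by positivity
    have hlog : ∀ {R : ℝ}, 0 ≤ (n : ℝ) * R →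
        R - 1 / n ≤ Real.logb 2 ⌊(2 : ℝ) ^ ((n : ℝ) * R)⌋₊ / n := by
      intro R hR
      rw [le_div_iff₀ hn', sub_mul, one_div, inv_mul_cancel₀ hn'.ne', mul_comm R]
      exact le_logb_floor hR
    have g₀ := hlog ht₀
    have g₁ := hlog ht₁
    refine ⟨f, hf, hineq.mono ?_ ?_ ?_ ?_⟩
    · dsimp only
      rw [sub_div, hδ]
      linarith
    · dsimp only
      rw [sub_div, hδ]
      linarith
    · dsimp only
      rw [sub_div, mul_div_assoc, hδ]
      linarith
    · dsimp only
      rw [sub_div, mul_div_assoc, hδ]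
      linarith
  have hcont : Tendsto (fun ε : ℝ => (R₀ - 2 * ε, R₁ - 2 * ε, Re₂ - 2 * ε, Re₃ - 2 * ε)) (𝓝[>] 0)
      (𝓝 (R₀, R₁, Re₂, Re₃)) := by
    have : Continuous fun ε : ℝ => (R₀ - 2 * ε, R₁ - 2 * ε, Re₂ - 2 * ε, Re₃ - 2 * ε) := by
      fun_prop
    simpa using (this.tendsto 0).mono_left nhdsWithin_le_nhds
  exact ch.isClosed_profileRegion.mem_of_tendsto hcont (eventually_mem_nhdsWithin.mono key)

end Codes

end

theorem proposition3 {𝒳 𝒴₁ 𝒵₂ 𝒵₃ : Type*} [Fintype 𝒳] [Fintype 𝒴₁] [Fintype 𝒵₂] [Fintype 𝒵₃]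
    (ch : BroadcastChannel 𝒳 𝒴₁ 𝒵₂ 𝒵₃) (hch : ch.IsMultilevel) :
    secrecyCapacityRegion ch ⊆ outerBound ch := by
  intro R hR
  obtain ⟨f, hf, h⟩ := closure_minimal (fun R hR => mem_profileRegion_of_isAchievable hch hR)
    ch.isClosed_profileRegion hR
  exact ch.mem_outerBound_of_profile hf h
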